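/- \textbf{Definitions.} A topological vector space $V$ over $\mathbb K\in\{\mathbb R,\mathbb C\}$ is a \emph{countably Hilbert space} if there are inner products $\langle\cdot,\cdot\rangle_p$, $p\in\mathbb N$, on $V$ whose norms $|\cdot|_p$ generate its topology and if it is complete; it is \emph{nuclear} if these can be chosen such that for every $p$ there is $q\ge p$ for which the canonical map from the completion of $(V,|\cdot|_q)$ to the completion of $(V,|\cdot|_p)$ is well defined and Hilbert--Schmidt. A topological group is a \emph{nuclear Lie group} if some neighbourhood of its unit element is homeomorphic, with the unit element corresponding to $0$, to a neighbourhood of $0$ in a countably Hilbert nuclear space. Let $C^\infty(\mathbb S^2)\subset L^2(\mathbb S^2)$ be the space of (classes up to null sets for the surface measure of) real smooth functions on the unit sphere $\mathbb S^2\subset\mathbb R^3$, with the usual $C^\infty$ topology of uniform convergence of all derivatives. For a real number $k>1$ let $A=L^2+k$ be the closure in $L^2(\mathbb S^2)$ (real-valued functions) of the operator $-\Delta_{\mathbb S^2}+k$ with domain $C^\infty(\mathbb S^2)$ (here the operator $L^2=-\Delta_{\mathbb S^2}$ is the squared angular momentum), and let $D(A^p)$ be the natural domain of its $p$-th power. \textbf{Theorem.}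 The additive group of supertranslations $C^\infty(\mathbb S^2)$ is an infinite-dimensional nuclear Lie group over $\mathbb R$. More precisely, for every real $k>1$: the operator $A$ is self-adjoint; $$\bigcap_{p\in\mathbb N}D(A^p)=C^\infty(\mathbb S^2);$$ and the formulas $\langle f,g\rangle_p=\langle A^pf,A^pg\rangle_{L^2(\mathbb S^2)}$, $p\in\mathbb N$, define inner products on $C^\infty(\mathbb S^2)$ whose norms generate the $C^\infty$ topology, for which $C^\infty(\mathbb S^2)$ is complete, and such that for every $p$ the canonical map from the completion with respect to $\langle\cdot,\cdot\rangle_{p+1}$ to the completion with respect to $\langle\cdot,\cdot\rangle_p$ is Hilbert--Schmidt. -/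

import Mathlib

open scoped Manifold ContDiff Topology InnerProductSpace

noncomputable section

namespace BMS

universe u

/-! ## Countably Hilbert nuclear spaces and nuclear Lie groups -/

/-- The (semi)norm `x ↦ √⟨x, x⟩` of an inner product on a vector space. -/
def innerNorm {𝕜 V : Type*} [RCLike 𝕜] [AddCommGroup V] [Module 𝕜 V]
    (c : InnerProductSpace.Core 𝕜 V) : Seminorm 𝕜 V :=
  @normSeminorm 𝕜 V _ c.toNormedAddCommGroup.toSeminormedAddCommGroup
    InnerProductSpace.Core.toNormedSpace

/-- The topological vector space `V` is a countably Hilbert space with respect to the sequence of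
inner products `c`: its topology is the one generated by the norms, and it is complete.
(The topology is metrizable, so completeness is completeness for Cauchy sequences.) -/
structure IsCountablyHilbert {𝕜 V : Type*} [RCLike 𝕜] [AddCommGroup V] [Module 𝕜 V]
    [TopologicalSpace V] (c : ℕ → InnerProductSpace.Core 𝕜 V) : Prop where
  withSeminorms : WithSeminorms (fun p : ℕ => innerNorm (c p))
  complete : ∀ u : ℕ → V,
    (∀ p : ℕ, ∀ ε : ℝ, 0 < ε → ∃ N : ℕ, ∀ m n : ℕ, N ≤ m → N ≤ n →
      innerNorm (c p) (u m - u n) < ε) →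
    ∃ v : V, ∀ p : ℕ, Filter.Tendsto (fun n => innerNorm (c p) (u n - v)) Filter.atTop (𝓝 0)

/-- The canonical map from the completion of `(V, c)` to the completion of `(V, d)`, induced by the
identity of `V`, is defined and Hilbert–Schmidt. As `V` is dense in its completions, this says that
the sums `∑ ‖e i‖²` (norm of `d`) over the finite `c`-orthonormal families of `V` are bounded. -/
def IsHilbertSchmidtInclusion {𝕜 V : Type*} [RCLike 𝕜] [AddCommGroup V] [Module 𝕜 V]
    (c d : InnerProductSpace.Core 𝕜 V) : Prop :=
  ∃ C : ℝ, ∀ (n : ℕ) (e : Fin n → V),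
    (∀ i j, c.inner (e i) (e j) = if i = j then 1 else 0) →
      ∑ i, innerNorm d (e i) ^ 2 ≤ C

/-- A countably Hilbert nuclear space: the inner products can be chosen such that each of the
associated Hilbert spaces receives a Hilbert–Schmidt canonical map from a later one. -/
def IsCountablyHilbertNuclear (𝕜 V : Type*) [RCLike 𝕜] [AddCommGroup V] [Module 𝕜 V]
    [TopologicalSpace V] : Prop :=
  ∃ c : ℕ → InnerProductSpace.Core 𝕜 V, IsCountablyHilbert c ∧
    ∀ p : ℕ, ∃ q : ℕ, p ≤ q ∧ IsHilbertSchmidtInclusion (c q) (c p)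

/-- A (topological, additively written) group is a nuclear Lie group if some neighbourhood of its
unit element is homeomorphic to a neighbourhood of zero in a countably Hilbert nuclear space
(with the unit element corresponding to zero). -/
def IsNuclearLieGroup (𝕜 : Type*) [RCLike 𝕜] (G : Type u) [AddGroup G] [TopologicalSpace G] :
    Prop :=
  IsTopologicalAddGroup G ∧
    ∃ (V : Type u) (_ : AddCommGroup V) (_ : Module 𝕜 V) (_ : TopologicalSpace V),
      IsCountablyHilbertNuclear 𝕜 V ∧
        ∃ U ∈ 𝓝 (0 : G), ∃ W ∈ 𝓝 (0 : V), ∃ φ : U ≃ₜ W,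
          ∀ g : U, (g : G) = 0 → (φ g : V) = 0

/-! ## Powers of an unbounded operator -/

/-- The power `A ^ p` of an unbounded operator, with its natural domain:
`D(A ^ 0)` is everything and `D(A ^ (p + 1)) = {x ∈ D(A ^ p) | A ^ p x ∈ D(A)}`. -/
def opPow {H : Type*} [AddCommGroup H] [Module ℝ H] (A : H →ₗ.[ℝ] H) : ℕ → (H →ₗ.[ℝ] H)
  | 0 => LinearMap.toPMap LinearMap.id ⊤
  | p + 1 =>
    A.comp
      ((opPow A p).domRestrict ((A.domain.comap (opPow A p).toFun).map (opPow A p).domain.subtype))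
      (by
        rintro ⟨x, ⟨⟨y, hy, rfl⟩, hx⟩⟩
        exact hy)

/-! ## Smooth functions on the two-sphere -/

/-- Euclidean three-space. -/
abbrev E3 : Type := EuclideanSpace ℝ (Fin 3)

/-- The unit two-sphere. -/
abbrev S2 : Type := Metric.sphere (0 : E3) 1

/-- Real smooth functions on the two-sphere. -/
abbrev SmoothS2 : Type := C^∞⟮𝓡 2, S2; 𝓘(ℝ, ℝ), ℝ⟯

/-- The canonical (surface) measure on the two-sphere, of total mass `4π`. -/
abbrev surfaceMeasure : MeasureTheory.Measure S2 :=
  (MeasureTheory.volume : MeasureTheory.Measure E3).toSphere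

/-- The real Hilbert space of square integrable functions on the two-sphere. -/
abbrev L2S2 : Type := MeasureTheory.Lp ℝ 2 surfaceMeasure

/-- The radial projection of a nonzero vector to the sphere. -/
def radialProj (y : E3) (hy : y ≠ 0) : S2 :=
  ⟨‖y‖⁻¹ • y, by
    rw [mem_sphere_zero_iff_norm, norm_smul, norm_inv, norm_norm,
      inv_mul_cancel₀ (norm_ne_zero_iff.mpr hy)]⟩

open Classical in
/-- The extension of a function on the sphere to a function on `ℝ³ ∖ {0}` that is constant on
rays (with the irrelevant value `0` at the origin). -/
def radialExt (f : S2 → ℝ) (y : E3) : ℝ :=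
  if hy : y ≠ 0 then f (radialProj y hy) else 0

theorem radialExt_add (f g : S2 → ℝ) : radialExt (f + g) = radialExt f + radialExt g := by
  funext y
  by_cases hy : y ≠ 0 <;> simp [radialExt, hy]

theorem radialExt_smul (r : ℝ) (f : S2 → ℝ) : radialExt (r • f) = r • radialExt f := by
  funext y
  by_cases hy : y ≠ 0 <;> simp [radialExt, hy]

/-- The radial extension of a smooth function is smooth away from the origin. -/
theorem contDiffAt_radialExt (f : SmoothS2) {y : E3} (hy : y ≠ 0) :
    ContDiffAt ℝ ∞ (radialExt f) y := by
  have : Fact (Module.finrank ℝ E3 = 2 + 1) := ⟨by simp⟩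
  let U : TopologicalSpace.Opens E3 := ⟨{0}ᶜ, isOpen_compl_singleton⟩
  have h1 : ContMDiff 𝓘(ℝ, E3) 𝓘(ℝ, E3) ∞ (fun z : U => ‖(z : E3)‖⁻¹ • (z : E3)) := by
    intro z
    have hz : (z : E3) ≠ 0 := z.2
    have h : ContDiffAt ℝ ∞ (fun w : E3 => ‖w‖⁻¹ • w) (z : E3) :=
      ((contDiffAt_norm ℝ hz).inv (norm_ne_zero_iff.mpr hz)).smul contDiffAt_id
    exact contMDiffAt_subtype_iff.mpr h.contMDiffAt
  have h2 := ContMDiff.codRestrict_sphere (n := 2) h1 (fun z => (radialProj z z.2).2)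
  have h3 := f.contMDiff.comp h2
  have h4 : ContMDiffAt 𝓘(ℝ, E3) 𝓘(ℝ, ℝ) ∞ (radialExt f) ((⟨y, hy⟩ : U) : E3) := by
    refine contMDiffAt_subtype_iff.mp ((h3 ⟨y, hy⟩).congr_of_eventuallyEq ?_)
    filter_upwards with z
    have hz : (z : E3) ≠ 0 := z.2
    simp only [radialExt, hz, ne_eq, not_false_eq_true, dif_pos]
    rfl
  exact h4.contDiffAt

theorem sphere_ne_zero (x : S2) : (x : E3) ≠ 0 := by
  intro h
  have := mem_sphere_zero_iff_norm.mp x.2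
  simp [h] at this

theorem contMDiff_laplacian_radialExt (f : SmoothS2) :
    ContMDiff (𝓡 2) 𝓘(ℝ, ℝ) ∞ (fun x : S2 => Laplacian.laplacian (radialExt f) (x : E3)) := by
  have : Fact (Module.finrank ℝ E3 = 2 + 1) := ⟨by simp⟩
  intro x
  have h : ContDiffAt ℝ ∞ (Laplacian.laplacian (radialExt f) : E3 → ℝ) (x : E3) := by
    rw [InnerProductSpace.laplacian_eq_iteratedFDeriv_stdOrthonormalBasis]
    refine ContDiffAt.sum fun i _ => ?_
    have h2 : ContDiffAt ℝ ∞ (iteratedFDeriv ℝ 2 (radialExt f)) (x : E3) :=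
      (contDiffAt_radialExt f (sphere_ne_zero x)).iteratedFDeriv_right
        (WithTop.coe_le_coe.mpr (le_top : (⊤ : ℕ∞) + 2 ≤ ⊤))
    exact ((ContinuousMultilinearMap.apply ℝ (fun _ : Fin 2 => E3) ℝ _).contDiff.contDiffAt).comp
      _ h2
  exact h.contMDiffAt.comp x (contMDiff_coe_sphere (n := 2) x)

theorem two_le_infty : (2 : WithTop ℕ∞) ≤ ∞ := by
  exact WithTop.coe_le_coe.mpr (le_top : (2 : ℕ∞) ≤ ⊤)

/-- The Laplace–Beltrami operator of the round unit sphere: the Euclidean Laplacian of the radially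
constant extension, restricted to the sphere. Its eigenvalues are `-l(l + 1)`, so the squared
angular momentum is its negative. -/
def sphereLaplacian : SmoothS2 →ₗ[ℝ] SmoothS2 where
  toFun f := ⟨fun x => Laplacian.laplacian (radialExt f) (x : E3),
    contMDiff_laplacian_radialExt f⟩
  map_add' f g := by
    ext x
    have hf := (contDiffAt_radialExt f (sphere_ne_zero x)).of_le (m := 2) two_le_infty
    have hg := (contDiffAt_radialExt g (sphere_ne_zero x)).of_le (m := 2) two_le_infty
    change Laplacian.laplacian (radialExt (f + g : S2 → ℝ)) (x : E3) = _
    rw [radialExt_add, hf.laplacian_add hg]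
    rfl
  map_smul' r f := by
    ext x
    have hf := (contDiffAt_radialExt f (sphere_ne_zero x)).of_le (m := 2) two_le_infty
    change Laplacian.laplacian (radialExt (r • f : S2 → ℝ)) (x : E3) = _
    rw [radialExt_smul, InnerProductSpace.laplacian_smul r hf]
    rfl

/-- The class in `L²` (equality almost everywhere) of a smooth function. -/
def toL2 : SmoothS2 →ₗ[ℝ] L2S2 where
  toFun f := ContinuousMap.toLp 2 surfaceMeasure ℝ (⟨f, f.contMDiff.continuous⟩ : C(S2, ℝ))
  map_add' f g := by
    rw [← map_add]
    rfl
  map_smul' r f := by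
    rw [RingHom.id_apply, ← map_smul]
    rfl

/-- The `C^∞` topology on the smooth functions on the sphere: uniform convergence on the sphere of
all derivatives (of the radially constant extensions). -/
@[reducible] def smoothTopology : TopologicalSpace SmoothS2 :=
  ⨅ n : ℕ, TopologicalSpace.induced
    (fun f : SmoothS2 => UniformFun.ofFun (fun x : S2 => iteratedFDeriv ℝ n (radialExt f) (x : E3)))
    inferInstance

/-- The space of classes of smooth functions up to null sets, as a subspace of `L²`. -/
def smoothClasses : Submodule ℝ L2S2 := LinearMap.range toL2

/-- The additive group (and vector space) of supertranslations: the smooth functions on the sphere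
up to equality almost everywhere. It carries the quotient of the `C^∞` topology, not the
topology of `L²`. -/
def Supertranslation : Type := smoothClasses

instance instAddCommGroupSupertranslation : AddCommGroup Supertranslation := inferInstanceAs (AddCommGroup smoothClasses)

instance instModuleSupertranslation : Module ℝ Supertranslation := inferInstanceAs (Module ℝ smoothClasses)

/-- The inclusion of the supertranslations in `L²`. -/
def Supertranslation.val (f : Supertranslation) : L2S2 := Subtype.val f

/-- The class of a smooth function as a supertranslation. -/
def Supertranslation.mk (f : SmoothS2) : Supertranslation := toL2.rangeRestrict f

instance instTopologicalSpaceSupertranslation : TopologicalSpace Supertranslation :=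
  TopologicalSpace.coinduced Supertranslation.mk smoothTopology

/-! ## The shifted spherical Laplacian -/

/-- The operator `A = L² + k` on the square integrable functions on the sphere, where `L²` is the
squared angular momentum operator, that is, minus the Laplace–Beltrami operator: the closure of
`-Δ + k` defined on the smooth functions. -/
def shiftedLaplacian (k : ℝ) : L2S2 →ₗ.[ℝ] L2S2 :=
  (LinearMap.range (toL2.prod (toL2 ∘ₗ (-sphereLaplacian + k • LinearMap.id)))).topologicalClosure
    |>.toLinearPMap

end BMS

end

/-!
The smooth functions on the sphere are studied through their radially constant extensions to
`ℝ³ ∖ {0}`, multiplied by a cut-off `χ(‖y‖²)` supported away from the origin (`cutFun χ f`). In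
polar coordinates the Euclidean Laplacian of such a function separates into a radial part and the
Laplace–Beltrami operator (`laplacian_cutFun`), so that analysis on the sphere reduces to analysis
on `ℝ³`; neither charts nor spherical harmonics are used.

*Self-adjointness.* The Euclidean Laplacian is symmetric, whence Green's formula on the sphere
(`integral_mul_sphereLaplacian`) and the symmetry of `A = -Δ + k` on smooth functions. The
restrictions to the sphere of the polynomials of degree at most `n` form a finite-dimensional
invariant subspace (`smoothOp_mem`), because `Δ` and the tangential gradient have explicit
commutators with the coordinates. The union of these subspaces is dense in `L²` by Stone–Weierstrass
(`dense_polySpace`). The orthogonal projections to them commute even with the adjoint of `A`, so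
every element of the graph of the adjoint is a limit of elements of the graph of `A`, and the
closure is self-adjoint (`isSelfAdjoint_closedGraph`). The same projections approximate a vector in
all the domains `D(A ^ p)` simultaneously (`exists_seq_tendsto_opPow`).

*Elliptic estimate.* By Fourier transformation and the Cauchy–Schwarz inequality, derivatives of
order `n` of a Schwartz function on `ℝ³` are bounded by the `L²` norm of `(1 - Δ) ^ (n + 1)` applied
to it. For `cutFun χ f`, the operator `1 - Δ` produces functions of the same form built from `f` and
`A f`; since `Δ ≤ 0` and `k > 1`, the norms `‖A ^ p f‖` increase with `p`. Hence the derivatives of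
order `n` are bounded by a multiple of `‖A ^ (n + 1) f‖` (`exists_norm_iteratedFDeriv_cutFun_le`).

*Consequences.* A sequence for which all `A ^ p fₙ` are Cauchy in `L²` converges to a
smooth function (`exists_tendsto_toL2`); this yields `⋂ D(A ^ p) = C^∞` and completeness. The elliptic
estimate and the continuity of the differential operator `A` show that
the norms `‖A ^ p f‖` generate the smooth topology (`smallDerivs_iff`). The case `n = 0` of the
estimate says `|f(x)| ≤ C ‖A f‖`; applied to linear combinations of functions `gᵢ` with `A gᵢ`
orthonormal it gives `∑ |gᵢ(x)|² ≤ C²` at every point (`exists_sum_sq_le`), and integration over the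
sphere bounds `∑ ‖gᵢ‖²`, which is the Hilbert–Schmidt property. Finally, the space is
infinite-dimensional since a coordinate function takes infinitely many values and so is not a root
of a nonzero polynomial.
-/

noncomputable section

namespace BMS

/-! ### A Sobolev inequality in three-space -/

section Sobolev

open SchwartzMap FourierTransform LineDeriv MeasureTheory
open scoped Laplacian

/-- The operator `1 - Δ` on Schwartz functions of three variables. -/
def oneSubLaplacian (F : 𝓢(E3, ℂ)) : 𝓢(E3, ℂ) := F - Δ F

/-- The Fourier symbol of `1 - Δ`. -/
def besselSymbol (ξ : E3) : ℝ := 1 + (2 * Real.pi) ^ 2 * ‖ξ‖ ^ 2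

theorem one_le_besselSymbol (ξ : E3) : 1 ≤ besselSymbol ξ :=
  le_add_of_nonneg_right (by positivity)

theorem fourier_oneSubLaplacian (F : 𝓢(E3, ℂ)) (ξ : E3) :
    𝓕 (oneSubLaplacian F) ξ = (besselSymbol ξ : ℂ) * 𝓕 F ξ := by
  have h : 𝓕 (oneSubLaplacian F) = 𝓕 F - 𝓕 (Δ F) :=
    (fourierTransformCLM ℂ).map_sub F (Δ F)
  rw [h, laplacian_eq_fourierMultiplierCLM, ← fourierMultiplierCLM_ofReal ℂ (by fun_prop),
    fourierMultiplierCLM_apply]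
  have h2 : 𝓕 (-(2 * Real.pi) ^ 2 • 𝓕⁻ (smulLeftCLM ℂ (fun x : E3 => ((‖x‖ ^ 2 : ℝ) : ℂ)) (𝓕 F)))
      = -(2 * Real.pi) ^ 2 • smulLeftCLM ℂ (fun x : E3 => ((‖x‖ ^ 2 : ℝ) : ℂ)) (𝓕 F) := by
    rw [FourierTransform.fourier_smul, FourierTransform.fourier_fourierInv_eq]
  simp only [RCLike.ofReal_eq_complex_ofReal]
  rw [h2]
  simp only [sub_apply, smul_apply]
  rw [smulLeftCLM_apply_apply (by fun_prop)]
  simp [besselSymbol]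
  ring

theorem fourier_iterate_oneSubLaplacian (n : ℕ) (F : 𝓢(E3, ℂ)) (ξ : E3) :
    𝓕 (oneSubLaplacian^[n] F) ξ = (besselSymbol ξ : ℂ) ^ n * 𝓕 F ξ := by
  induction n generalizing F with
  | zero => simp
  | succ n ih =>
    rw [Function.iterate_succ_apply, ih, fourier_oneSubLaplacian]
    ring

theorem norm_fourier_lineDerivOp_le (F : 𝓢(E3, ℂ)) (v ξ : E3) :
    ‖𝓕 (∂_{v} F) ξ‖ ≤ ‖v‖ * (besselSymbol ξ * ‖𝓕 F ξ‖) := by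
  rw [SchwartzMap.fourier_lineDerivOp_eq, smul_apply,
    smulLeftCLM_apply_apply (by fun_prop)]
  have h1 : ‖inner ℝ ξ v‖ ≤ ‖ξ‖ * ‖v‖ := norm_inner_le_norm ξ v
  have h2 : 2 * Real.pi * ‖ξ‖ ≤ besselSymbol ξ := by
    unfold besselSymbol
    nlinarith [sq_nonneg (2 * Real.pi * ‖ξ‖ - 1), Real.pi_pos, norm_nonneg ξ]
  have h3 : ‖(2 * (Real.pi : ℂ) * Complex.I)‖ = 2 * Real.pi := by
    simp [abs_of_pos Real.pi_pos]
  rw [norm_smul, norm_smul, h3]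
  calc 2 * Real.pi * (‖inner ℝ ξ v‖ * ‖𝓕 F ξ‖)
      ≤ 2 * Real.pi * ((‖ξ‖ * ‖v‖) * ‖𝓕 F ξ‖) := by gcongr
    _ = ‖v‖ * ((2 * Real.pi * ‖ξ‖) * ‖𝓕 F ξ‖) := by ring
    _ ≤ _ := by gcongr

theorem norm_fourier_iteratedLineDerivOp_le (n : ℕ) (F : 𝓢(E3, ℂ)) (m : Fin n → E3) (ξ : E3) :
    ‖𝓕 (∂^{m} F) ξ‖ ≤ (∏ i, ‖m i‖) * (besselSymbol ξ ^ n * ‖𝓕 F ξ‖) := by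
  induction n with
  | zero => simp
  | succ n ih =>
    have hs : 0 ≤ besselSymbol ξ := zero_le_one.trans (one_le_besselSymbol ξ)
    rw [iteratedLineDerivOp_succ_left]
    refine (norm_fourier_lineDerivOp_le _ _ _).trans ?_
    calc ‖m 0‖ * (besselSymbol ξ * ‖𝓕 (∂^{Fin.tail m} F) ξ‖)
        ≤ ‖m 0‖ * (besselSymbol ξ *
          ((∏ i, ‖Fin.tail m i‖) * (besselSymbol ξ ^ n * ‖𝓕 F ξ‖))) := by
          gcongr
          exact ih _
      _ = _ := by
          rw [Fin.prod_univ_succ]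
          simp only [Fin.tail]
          ring

/-- Fourier inversion bounds the sup norm by the `L¹` norm of the Fourier transform. -/
theorem norm_le_integral_norm_fourier (F : 𝓢(E3, ℂ)) (x : E3) : ‖F x‖ ≤ ∫ ξ, ‖𝓕 F ξ‖ := by
  have h : F x = 𝓕⁻ (⇑(𝓕 F : 𝓢(E3, ℂ))) x := by
    have h0 : (𝓕⁻ (𝓕 F : 𝓢(E3, ℂ)) : 𝓢(E3, ℂ)) = F := FourierTransform.fourierInv_fourier_eq F
    rw [← SchwartzMap.fourierInv_coe, h0]
  rw [h, Real.fourierInv_eq]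
  refine (norm_integral_le_integral_norm _).trans (le_of_eq ?_)
  congr 1
  ext ξ
  simp [Circle.norm_smul]

/-- This is where the dimension enters: the inverse symbol decays like `‖ξ‖⁻²`, which is square
integrable in dimension three. -/
theorem memLp_inv_besselSymbol :
    MemLp (fun ξ : E3 => (besselSymbol ξ)⁻¹) 2 := by
  have hc : Continuous besselSymbol := by unfold besselSymbol; fun_prop
  have hpos : ∀ ξ, 0 < besselSymbol ξ := fun ξ => zero_lt_one.trans_le (one_le_besselSymbol ξ)
  have hcont : Continuous (fun ξ : E3 => (besselSymbol ξ)⁻¹) :=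
    hc.inv₀ fun ξ => (hpos ξ).ne'
  rw [memLp_two_iff_integrable_sq hcont.aestronglyMeasurable]
  have h := integrable_rpow_neg_one_add_norm_sq (E := E3) (μ := volume) (r := 4) (by simp; norm_num)
  refine h.mono' (hcont.pow 2).aestronglyMeasurable (Filter.Eventually.of_forall fun ξ => ?_)
  have h1 : 1 + ‖ξ‖ ^ 2 ≤ besselSymbol ξ := by
    unfold besselSymbol
    have : (1 : ℝ) ≤ (2 * Real.pi) ^ 2 := by nlinarith [Real.pi_gt_three]
    nlinarith [sq_nonneg ‖ξ‖]
  rw [Real.norm_of_nonneg (by positivity), show (-4 / 2 : ℝ) = ((-2 : ℤ) : ℝ) by norm_num,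
    Real.rpow_intCast, zpow_neg, inv_pow]
  exact inv_anti₀ (by positivity) (by exact_mod_cast pow_le_pow_left₀ (by positivity) h1 2)

/-- **Sobolev inequality**: the derivatives of order `n` of a Schwartz function on three-space are
bounded uniformly by the `L²` norm of `(1 - Δ) ^ (n + 1)` applied to it: `n` factors of the symbol
control the derivatives, and the remaining one makes the Fourier transform integrable. -/
theorem exists_norm_iteratedFDeriv_le : ∃ K : ℝ, 0 ≤ K ∧ ∀ (n : ℕ) (F : 𝓢(E3, ℂ)) (x : E3),
    ‖iteratedFDeriv ℝ n F x‖ ≤ K * Real.sqrt (∫ y, ‖oneSubLaplacian^[n + 1] F y‖ ^ 2) := by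
  refine ⟨Real.sqrt (∫ ξ : E3, (besselSymbol ξ)⁻¹ ^ 2), Real.sqrt_nonneg _, fun n F x => ?_⟩
  set G := oneSubLaplacian^[n + 1] F with hG
  have hpos : ∀ ξ, 0 < besselSymbol ξ := fun ξ => zero_lt_one.trans_le (one_le_besselSymbol ξ)
  have hmem : MemLp (fun ξ => ‖𝓕 G ξ‖) 2 := ((𝓕 G).memLp 2).norm
  have hCS : ∫ ξ, (besselSymbol ξ)⁻¹ * ‖𝓕 G ξ‖ ≤
      Real.sqrt (∫ ξ : E3, (besselSymbol ξ)⁻¹ ^ 2) * Real.sqrt (∫ y, ‖G y‖ ^ 2) := by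
    have h := integral_mul_le_Lp_mul_Lq_of_nonneg (μ := (volume : Measure E3))
      Real.HolderConjugate.two_two
      (f := fun ξ => (besselSymbol ξ)⁻¹) (g := fun ξ => ‖𝓕 G ξ‖)
      (Filter.Eventually.of_forall fun ξ => (inv_pos.mpr (hpos ξ)).le)
      (Filter.Eventually.of_forall fun ξ => norm_nonneg _)
      (by simpa using memLp_inv_besselSymbol) (by simpa using hmem)
    rw [← SchwartzMap.integral_norm_sq_fourier G, Real.sqrt_eq_rpow, Real.sqrt_eq_rpow]
    simpa using h
  have hint : Integrable (fun ξ => (besselSymbol ξ)⁻¹ * ‖𝓕 G ξ‖) :=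
    memLp_inv_besselSymbol.integrable_mul hmem
  refine ContinuousMultilinearMap.opNorm_le_bound (by positivity) fun m => ?_
  rw [← SchwartzMap.iteratedLineDerivOp_eq_iteratedFDeriv]
  calc ‖(∂^{m} F) x‖ ≤ ∫ ξ, ‖𝓕 (∂^{m} F) ξ‖ := norm_le_integral_norm_fourier _ _
    _ ≤ ∫ ξ, (∏ i, ‖m i‖) * ((besselSymbol ξ)⁻¹ * ‖𝓕 G ξ‖) := by
        refine integral_mono (𝓕 (∂^{m} F)).integrable.norm (hint.const_mul _) fun ξ => ?_
        refine (norm_fourier_iteratedLineDerivOp_le n F m ξ).trans (le_of_eq ?_)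
        rw [hG, fourier_iterate_oneSubLaplacian, norm_mul, norm_pow, Complex.norm_real,
          Real.norm_of_nonneg (hpos ξ).le]
        field_simp [(hpos ξ).ne']
        ring
    _ = (∏ i, ‖m i‖) * ∫ ξ, (besselSymbol ξ)⁻¹ * ‖𝓕 G ξ‖ := integral_const_mul _ _
    _ ≤ (∏ i, ‖m i‖) * (Real.sqrt (∫ ξ : E3, (besselSymbol ξ)⁻¹ ^ 2) *
          Real.sqrt (∫ y, ‖G y‖ ^ 2)) := by gcongr
    _ = _ := mul_comm _ _

end Sobolev

/-! ### Euclidean calculus of radially constant functions -/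

section Calculus

open scoped Laplacian

theorem laplacian_eq_sum_fderiv (f : E3 → ℝ) (x : E3) :
    Δ f x = ∑ i : Fin 3, fderiv ℝ (fderiv ℝ f) x (EuclideanSpace.single i 1)
      (EuclideanSpace.single i 1) := by
  rw [InnerProductSpace.laplacian_eq_iteratedFDeriv_orthonormalBasis f
    (EuclideanSpace.basisFun (Fin 3) ℝ)]
  simp [iteratedFDeriv_two_apply]

theorem apply_eq_sum_single (L : E3 →L[ℝ] ℝ) (y : E3) :
    L y = ∑ i : Fin 3, y i * L (EuclideanSpace.single i 1) := by
  have h : y = ∑ i : Fin 3, y i • (EuclideanSpace.single i (1 : ℝ) : E3) := by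
    ext j
    fin_cases j <;> simp [Fin.sum_univ_three]
  conv_lhs => rw [h]
  simp only [map_sum, map_smul, smul_eq_mul]

/-- The product rule `Δ(uv) = u Δv + v Δu + 2 ∇u · ∇v`. -/
theorem laplacian_mul {u v : E3 → ℝ} {x : E3} (hu : ContDiffAt ℝ 2 u x)
    (hv : ContDiffAt ℝ 2 v x) :
    Δ (fun y => u y * v y) x = u x * Δ v x + v x * Δ u x +
      2 * ∑ i : Fin 3, fderiv ℝ u x (EuclideanSpace.single i 1) *
        fderiv ℝ v x (EuclideanSpace.single i 1) := by
  have h1 : fderiv ℝ (fun y => u y * v y) =ᶠ[𝓝 x]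
      fun y => u y • fderiv ℝ v y + v y • fderiv ℝ u y := by
    filter_upwards [hu.eventually (by simp), hv.eventually (by simp)] with y hy hy'
    exact fderiv_fun_mul (hy.differentiableAt (by simp)) (hy'.differentiableAt (by simp))
  have du : DifferentiableAt ℝ u x := hu.differentiableAt (by simp)
  have dv : DifferentiableAt ℝ v x := hv.differentiableAt (by simp)
  have du' : DifferentiableAt ℝ (fderiv ℝ u) x :=
    (hu.fderiv_right (m := 1) (by norm_num)).differentiableAt (by simp)
  have dv' : DifferentiableAt ℝ (fderiv ℝ v) x :=
    (hv.fderiv_right (m := 1) (by norm_num)).differentiableAt (by simp)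
  simp only [laplacian_eq_sum_fderiv]
  rw [h1.fderiv_eq, fderiv_fun_add (du.fun_smul dv') (dv.fun_smul du'),
    fderiv_fun_smul du dv', fderiv_fun_smul dv du']
  simp only [Fin.sum_univ_three, add_apply, smul_apply, ContinuousLinearMap.smulRight_apply,
    smul_eq_mul]
  ring

/-- The gradient of a radial function. -/
theorem hasFDerivAt_comp_norm_sq {χ : ℝ → ℝ} {y : E3} (h : DifferentiableAt ℝ χ (‖y‖ ^ 2)) :
    HasFDerivAt (fun z : E3 => χ (‖z‖ ^ 2)) ((2 * deriv χ (‖y‖ ^ 2)) • innerSL ℝ y) y := by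
  have h1 := h.hasDerivAt.comp_hasFDerivAt y (hasStrictFDerivAt_norm_sq y).hasFDerivAt
  refine h1.congr_fderiv ?_
  ext v
  simp
  ring

/-- The Laplacian of a radial function in dimension three. -/
theorem laplacian_comp_norm_sq {χ : ℝ → ℝ} {y : E3} (h : ContDiffAt ℝ 2 χ (‖y‖ ^ 2)) :
    Δ (fun z : E3 => χ (‖z‖ ^ 2)) y =
      4 * ‖y‖ ^ 2 * deriv (deriv χ) (‖y‖ ^ 2) + 6 * deriv χ (‖y‖ ^ 2) := by
  have hc : Filter.Tendsto (fun z : E3 => ‖z‖ ^ 2) (𝓝 y) (𝓝 (‖y‖ ^ 2)) :=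
    (continuous_norm.pow 2).continuousAt
  have h1 : fderiv ℝ (fun z : E3 => χ (‖z‖ ^ 2)) =ᶠ[𝓝 y]
      fun z => (2 * deriv χ (‖z‖ ^ 2)) • innerSL ℝ z := by
    filter_upwards [hc.eventually (h.eventually (by simp))] with z hz
    exact (hasFDerivAt_comp_norm_sq (hz.differentiableAt (by simp))).fderiv
  have h2 : DifferentiableAt ℝ (deriv χ) (‖y‖ ^ 2) := by
    have : ContDiffAt ℝ 1 (fderiv ℝ χ) (‖y‖ ^ 2) := h.fderiv_right (by norm_num)
    have h3 : deriv χ = fun t => fderiv ℝ χ t 1 := by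
      ext t
      simp
    rw [h3]
    exact (this.differentiableAt (by simp)).clm_apply (differentiableAt_const _)
  have h3 := hasFDerivAt_comp_norm_sq h2
  have h4 : HasFDerivAt (fun z : E3 => (2 * deriv χ (‖z‖ ^ 2)) • innerSL ℝ z) _ y :=
    (h3.const_mul 2).fun_smul (innerSL ℝ : E3 →L[ℝ] E3 →L[ℝ] ℝ).hasFDerivAt
  rw [laplacian_eq_sum_fderiv, h1.fderiv_eq, h4.fderiv]
  have h5 : ‖y‖ ^ 2 = y 0 ^ 2 + y 1 ^ 2 + y 2 ^ 2 := by
    rw [EuclideanSpace.norm_sq_eq]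
    simp [Fin.sum_univ_three]
  have h6 : ∀ i : Fin 3, (innerSL ℝ : E3 →L[ℝ] E3 →L[ℝ] ℝ) (EuclideanSpace.single i 1)
      (EuclideanSpace.single i 1) = 1 := fun i => by
    change inner ℝ (EuclideanSpace.single i (1 : ℝ)) (EuclideanSpace.single i (1 : ℝ)) = 1
    simp
  have h7 : ∀ i : Fin 3, inner ℝ y (EuclideanSpace.single i (1 : ℝ)) = y i := fun i => by
    simp [EuclideanSpace.inner_single_right]
  simp only [Fin.sum_univ_three, add_apply, smul_apply, ContinuousLinearMap.smulRight_apply, h6,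
    innerSL_apply_apply, h7, smul_eq_mul]
  generalize deriv (deriv χ) (‖y‖ ^ 2) = a
  generalize deriv χ (‖y‖ ^ 2) = b
  rw [h5]
  ring

theorem radialExt_apply_sphere (f : S2 → ℝ) (x : S2) : radialExt f (x : E3) = f x := by
  rw [radialExt, dif_pos (sphere_ne_zero x)]
  congr 1
  ext1
  simp [radialProj, mem_sphere_zero_iff_norm.mp x.2]

theorem radialExt_smul_vec (f : S2 → ℝ) {c : ℝ} (hc : 0 < c) (y : E3) :
    radialExt f (c • y) = radialExt f y := by
  by_cases hy : y = 0
  · simp [hy]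
  · have hcy : c • y ≠ 0 := smul_ne_zero hc.ne' hy
    rw [radialExt, radialExt, dif_pos hcy, dif_pos hy]
    congr 1
    ext1
    simp only [radialProj, norm_smul, Real.norm_of_nonneg hc.le, mul_inv, smul_smul]
    congr 1
    field_simp

theorem radialExt_mul (f g : S2 → ℝ) : radialExt (f * g) = radialExt f * radialExt g := by
  funext y
  by_cases hy : y ≠ 0 <;> simp [radialExt, hy]

/-- Euler's relation for the radially constant extension. -/
theorem fderiv_radialExt_self (f : SmoothS2) {y : E3} (hy : y ≠ 0) :
    fderiv ℝ (radialExt f) y y = 0 := by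
  have hd : DifferentiableAt ℝ (radialExt f) ((1 : ℝ) • y) := by
    rw [one_smul]
    exact (contDiffAt_radialExt f hy).differentiableAt (by simp)
  have h1 : HasDerivAt (fun t : ℝ => radialExt f (t • y)) (fderiv ℝ (radialExt f) y y) 1 := by
    have h2 : HasDerivAt (fun t : ℝ => t • y) y 1 := by
      simpa using (hasDerivAt_id (1 : ℝ)).smul_const y
    have := hd.hasFDerivAt.comp_hasDerivAt 1 h2
    rwa [one_smul] at this
  have h3 : (fun t : ℝ => radialExt f (t • y)) =ᶠ[𝓝 1] fun _ => radialExt f y := by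
    filter_upwards [lt_mem_nhds (zero_lt_one' ℝ)] with t ht
    exact radialExt_smul_vec f ht y
  exact (h1.congr_of_eventuallyEq h3.symm).unique (hasDerivAt_const 1 _)

theorem fderiv_radialExt_smul (f : S2 → ℝ) {c : ℝ} (hc : 0 < c) :
    fderiv ℝ (radialExt f) = fun y => c • fderiv ℝ (radialExt f) (c • y) := by
  funext y
  conv_lhs => rw [show radialExt f = fun z => radialExt f (c • z) from
    funext fun z => (radialExt_smul_vec f hc z).symm]
  rw [fderiv_comp_smul]

/-- The Laplacian of the radially constant extension is homogeneous of degree `-2`. -/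
theorem laplacian_radialExt (f : SmoothS2) {y : E3} (hy : y ≠ 0) :
    Δ (radialExt f) y = (‖y‖ ^ 2)⁻¹ * radialExt (sphereLaplacian f) y := by
  have hn : 0 < ‖y‖ := norm_pos_iff.mpr hy
  have hc : 0 < ‖y‖⁻¹ := inv_pos.mpr hn
  have h1 : radialExt (sphereLaplacian f) y = Δ (radialExt f) (‖y‖⁻¹ • y) := by
    rw [radialExt, dif_pos hy]
    rfl
  rw [h1, laplacian_eq_sum_fderiv, laplacian_eq_sum_fderiv, Finset.mul_sum]
  refine Finset.sum_congr rfl fun i _ => ?_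
  have hd : fderiv ℝ (fderiv ℝ (radialExt f)) y =
      ‖y‖⁻¹ • ‖y‖⁻¹ • fderiv ℝ (fderiv ℝ (radialExt f)) (‖y‖⁻¹ • y) := by
    conv_lhs => rw [fderiv_radialExt_smul f hc]
    refine (congrFun (fderiv_const_smul_field (𝕜 := ℝ)
      (f := fun z => fderiv ℝ (radialExt f) (‖y‖⁻¹ • z)) ‖y‖⁻¹) y).trans ?_
    rw [Pi.smul_apply, fderiv_comp_smul]
  rw [hd]
  simp only [smul_apply, smul_eq_mul]
  ring

/-- The product rule for the Laplace–Beltrami operator. -/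
theorem sphereLaplacian_mul (f g : SmoothS2) (x : S2) :
    sphereLaplacian (f * g) x = f x * sphereLaplacian g x + g x * sphereLaplacian f x +
      2 * ∑ i : Fin 3, fderiv ℝ (radialExt f) x (EuclideanSpace.single i 1) *
        fderiv ℝ (radialExt g) x (EuclideanSpace.single i 1) := by
  have hf := (contDiffAt_radialExt f (sphere_ne_zero x)).of_le two_le_infty
  have hg := (contDiffAt_radialExt g (sphere_ne_zero x)).of_le two_le_infty
  have h := laplacian_mul hf hg
  rw [radialExt_apply_sphere, radialExt_apply_sphere] at h
  rw [show sphereLaplacian (f * g) x = Δ (radialExt (f * g : S2 → ℝ)) (x : E3) from rfl,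
    radialExt_mul]
  exact h

end Calculus

/-! ### Radial cut-offs -/

section Cutoff

open scoped Laplacian
open MeasureTheory

/-- Smooth functions of a real variable with compact support in `(0, ∞)`; they are used as
functions of `‖y‖ ^ 2`. -/
structure IsRadialCutoff (χ : ℝ → ℝ) : Prop where
  contDiff : ContDiff ℝ ∞ χ
  vanish : ∃ a b : ℝ, 0 < a ∧ ∀ t, t ∉ Set.Icc a b → χ t = 0

/-- A factor `g` that is smooth on `(0, ∞)` only is allowed, since `χ` vanishes near `(-∞, 0]`. -/
theorem IsRadialCutoff.mul_left {χ : ℝ → ℝ} (h : IsRadialCutoff χ) {g : ℝ → ℝ}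
    (hg : ∀ t, 0 < t → ContDiffAt ℝ ∞ g t) : IsRadialCutoff (fun t => g t * χ t) := by
  obtain ⟨a, b, ha, hab⟩ := h.vanish
  refine ⟨?_, a, b, ha, fun t ht => by simp [hab t ht]⟩
  rw [contDiff_iff_contDiffAt]
  intro t
  rcases lt_or_ge 0 t with ht | ht
  · exact (hg t ht).mul h.contDiff.contDiffAt
  · have : (fun t => g t * χ t) =ᶠ[𝓝 t] fun _ => 0 := by
      filter_upwards [gt_mem_nhds (ht.trans_lt ha)] with s hs
      simp [hab s fun h => hs.not_ge h.1]
    exact contDiffAt_const.congr_of_eventuallyEq this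

theorem IsRadialCutoff.sub {χ ψ : ℝ → ℝ} (h : IsRadialCutoff χ) (h' : IsRadialCutoff ψ) :
    IsRadialCutoff (fun t => χ t - ψ t) := by
  obtain ⟨a, b, ha, hab⟩ := h.vanish
  obtain ⟨a', b', ha', hab'⟩ := h'.vanish
  refine ⟨h.contDiff.sub h'.contDiff, min a a', max b b', lt_min ha ha', fun t ht => ?_⟩
  rw [hab t fun hh => ht ⟨(min_le_left _ _).trans hh.1, hh.2.trans (le_max_left _ _)⟩,
    hab' t fun hh => ht ⟨(min_le_right _ _).trans hh.1, hh.2.trans (le_max_right _ _)⟩, sub_zero]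

theorem IsRadialCutoff.add {χ ψ : ℝ → ℝ} (h : IsRadialCutoff χ) (h' : IsRadialCutoff ψ) :
    IsRadialCutoff (fun t => χ t + ψ t) := by
  have := h.sub (h'.mul_left (g := fun _ => -1) fun _ _ => contDiffAt_const)
  simpa using this

theorem IsRadialCutoff.deriv {χ : ℝ → ℝ} (h : IsRadialCutoff χ) : IsRadialCutoff (deriv χ) := by
  obtain ⟨a, b, ha, hab⟩ := h.vanish
  refine ⟨?_, a, b, ha, fun t ht => ?_⟩
  · have := h.contDiff.iterate_deriv 1
    simpa using this
  · have : χ =ᶠ[𝓝 t] fun _ => 0 := by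
      filter_upwards [isClosed_Icc.isOpen_compl.mem_nhds ht] with s hs
      exact hab s hs
    rw [this.deriv_eq, deriv_const]

/-- The radial part of the Laplacian, as an operator on functions of `t = ‖y‖ ^ 2`. -/
def radialLaplacian (χ : ℝ → ℝ) (t : ℝ) : ℝ := 4 * t * deriv (deriv χ) t + 6 * deriv χ t

theorem IsRadialCutoff.radialLaplacian {χ : ℝ → ℝ} (h : IsRadialCutoff χ) :
    IsRadialCutoff (radialLaplacian χ) :=
  (h.deriv.deriv.mul_left (g := fun t => 4 * t) fun _ _ => by fun_prop).add
    (h.deriv.mul_left (g := fun _ => 6) fun _ _ => contDiffAt_const)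

theorem IsRadialCutoff.inv_mul {χ : ℝ → ℝ} (h : IsRadialCutoff χ) :
    IsRadialCutoff (fun t => t⁻¹ * χ t) :=
  h.mul_left fun _ ht => contDiffAt_inv ℝ ht.ne'

/-- The function on three-space that is `f` in the angular variables, cut off radially by `χ`. -/
def cutFun (χ : ℝ → ℝ) (f : S2 → ℝ) (y : E3) : ℝ := χ (‖y‖ ^ 2) * radialExt f y

theorem IsRadialCutoff.eventually_eq_zero {χ : ℝ → ℝ} (h : IsRadialCutoff χ) :
    ∀ᶠ y : E3 in 𝓝 0, χ (‖y‖ ^ 2) = 0 := by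
  obtain ⟨a, b, ha, hab⟩ := h.vanish
  have hc : Filter.Tendsto (fun z : E3 => ‖z‖ ^ 2) (𝓝 0) (𝓝 0) := by
    have : ContinuousAt (fun z : E3 => ‖z‖ ^ 2) 0 := (continuous_norm.pow 2).continuousAt
    simpa [ContinuousAt] using this
  filter_upwards [hc.eventually (gt_mem_nhds ha)] with y hy
  exact hab _ fun hh => hy.not_ge hh.1

theorem IsRadialCutoff.contDiff_cutFun {χ : ℝ → ℝ} (h : IsRadialCutoff χ) (f : SmoothS2) :
    ContDiff ℝ ∞ (cutFun χ f) := by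
  rw [contDiff_iff_contDiffAt]
  intro y
  by_cases hy : y = 0
  · subst hy
    refine (contDiffAt_const (c := (0 : ℝ))).congr_of_eventuallyEq ?_
    filter_upwards [h.eventually_eq_zero] with y hy
    simp [cutFun, hy]
  · exact ((h.contDiff.comp (contDiff_norm_sq ℝ)).contDiffAt).mul (contDiffAt_radialExt f hy)

theorem IsRadialCutoff.hasCompactSupport_cutFun {χ : ℝ → ℝ} (h : IsRadialCutoff χ) (f : S2 → ℝ) :
    HasCompactSupport (cutFun χ f) := by
  obtain ⟨a, b, ha, hab⟩ := h.vanish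
  refine HasCompactSupport.intro (isCompact_closedBall (0 : E3) (Real.sqrt b)) fun y hy => ?_
  rw [cutFun, hab, zero_mul]
  intro hh
  apply hy
  rw [mem_closedBall_zero_iff]
  exact Real.le_sqrt_of_sq_le hh.2

/-- The Euclidean Laplacian separates: there is no mixed term, because the gradient of the radial
factor is orthogonal to that of a radially constant function. -/
theorem laplacian_cutFun {χ : ℝ → ℝ} (h : IsRadialCutoff χ) (f : SmoothS2) (y : E3) :
    Δ (cutFun χ f) y = cutFun (radialLaplacian χ) f y +
      cutFun (fun t => t⁻¹ * χ t) (sphereLaplacian f) y := by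
  by_cases hy : y = 0
  · subst hy
    have h0 : cutFun χ f =ᶠ[𝓝 0] fun _ => (0 : ℝ) := by
      filter_upwards [h.eventually_eq_zero] with y hy
      simp [cutFun, hy]
    -- On the right the junk value of `radialExt` at the origin makes both terms vanish.
    rw [InnerProductSpace.laplacian_congr_nhds h0 |>.eq_of_nhds]
    simp [cutFun, radialExt]
  · have h1 : ContDiffAt ℝ 2 (fun z : E3 => χ (‖z‖ ^ 2)) y :=
      ((h.contDiff.of_le two_le_infty).comp (contDiff_norm_sq ℝ)).contDiffAt
    have h2 : ContDiffAt ℝ 2 χ (‖y‖ ^ 2) := (h.contDiff.of_le two_le_infty).contDiffAt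
    have h3 : ContDiffAt ℝ 2 (radialExt f) y := (contDiffAt_radialExt f hy).of_le two_le_infty
    have h4 := laplacian_mul h1 h3
    have h5 : ∑ i : Fin 3, fderiv ℝ (fun z : E3 => χ (‖z‖ ^ 2)) y (EuclideanSpace.single i 1) *
        fderiv ℝ (radialExt f) y (EuclideanSpace.single i 1) = 0 := by
      rw [(hasFDerivAt_comp_norm_sq (h2.differentiableAt (by simp))).fderiv]
      have h6 := fderiv_radialExt_self f hy
      rw [apply_eq_sum_single] at h6
      simp only [smul_apply, innerSL_apply_apply, EuclideanSpace.inner_single_right, smul_eq_mul,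
        one_mul, conj_trivial, mul_assoc]
      rw [← Finset.mul_sum, ← Finset.mul_sum, h6, mul_zero, mul_zero]
    rw [show cutFun χ f = fun z => χ (‖z‖ ^ 2) * radialExt f z from rfl, h4, h5,
      laplacian_radialExt f hy, laplacian_comp_norm_sq h2]
    simp only [cutFun, radialLaplacian]
    ring

end Cutoff

/-! ### Polar coordinates and Green's formula -/

section Green

open scoped Laplacian
open MeasureTheory

/-- The integral of a radial profile `χ(r²)` against the measure `r² dr` on `(0, ∞)`. -/
def radialMass (χ : ℝ → ℝ) : ℝ :=
  ∫ r : Set.Ioi (0 : ℝ), χ (r.1 ^ 2) ∂(Measure.volumeIoiPow (Module.finrank ℝ E3 - 1))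

/-- Integration in polar coordinates. -/
theorem integral_cutFun (χ : ℝ → ℝ) (g : S2 → ℝ) :
    ∫ y, cutFun χ g y = radialMass χ * ∫ x, g x ∂surfaceMeasure := by
  have h1 : ∫ y, cutFun χ g y =
      ∫ y : ({0}ᶜ : Set E3), cutFun χ g y.1 ∂((volume : Measure E3).comap Subtype.val) := by
    rw [integral_subtype_comap (measurableSet_singleton _).compl fun y => cutFun χ g y,
      restrict_compl_singleton]
  have h2 := (volume : Measure E3).measurePreserving_homeomorphUnitSphereProd.integral_comp
    (Homeomorph.measurableEmbedding _)
    (fun p : S2 × Set.Ioi (0 : ℝ) => g p.1 * χ (p.2.1 ^ 2))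
  rw [h1, radialMass, mul_comm, ← integral_prod_mul, ← h2]
  congr 1
  funext y
  have hy : (y : E3) ≠ 0 := y.2
  rw [cutFun, radialExt, dif_pos hy, mul_comm, homeomorphUnitSphereProd_apply_snd_coe]
  congr 2
  ext1
  simp [radialProj]

theorem cutFun_mul_cutFun (χ ψ : ℝ → ℝ) (f g : S2 → ℝ) (y : E3) :
    cutFun χ f y * cutFun ψ g y = cutFun (fun t => χ t * ψ t) (f * g) y := by
  simp only [cutFun, radialExt_mul, Pi.mul_apply]
  ring

theorem integral_cutFun_mul_cutFun (χ ψ : ℝ → ℝ) (f g : S2 → ℝ) :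
    ∫ y, cutFun χ f y * cutFun ψ g y =
      radialMass (fun t => χ t * ψ t) * ∫ x, f x * g x ∂surfaceMeasure := by
  simp only [cutFun_mul_cutFun, integral_cutFun, Pi.mul_apply]

/-- The mass is positive because the function `χ(‖y‖²)` has a positive integral over three-space. -/
theorem radialMass_pos {χ : ℝ → ℝ} (h : IsRadialCutoff χ) (h0 : ∀ t, 0 ≤ χ t) (h1 : χ 1 ≠ 0) :
    0 < radialMass χ := by
  have hcut : ∀ y, cutFun χ (1 : SmoothS2) y = χ (‖y‖ ^ 2) := by
    intro y
    by_cases hy : y = 0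
    · subst hy
      have := h.eventually_eq_zero.self_of_nhds
      rw [cutFun, this, zero_mul]
    · simp [cutFun, radialExt, hy]
  have hpos : 0 < ∫ y, cutFun χ (1 : SmoothS2) y := by
    refine (h.contDiff_cutFun 1).continuous.integral_pos_of_hasCompactSupport_nonneg_nonzero
      (x := EuclideanSpace.single 0 1) (h.hasCompactSupport_cutFun _) (fun y => ?_) ?_
    · rw [hcut]
      exact h0 _
    · rw [hcut]
      simpa using h1
  rw [integral_cutFun] at hpos
  have h2 : (0 : ℝ) ≤ ∫ x, (1 : SmoothS2) x ∂surfaceMeasure :=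
    integral_nonneg fun x => by simp
  by_contra hc
  exact absurd hpos (mul_nonpos_of_nonpos_of_nonneg (not_lt.mp hc) h2).not_gt

/-- There is a nonnegative radial cut-off that equals one near the unit sphere. -/
theorem exists_isRadialCutoff : ∃ χ : ℝ → ℝ, IsRadialCutoff χ ∧ (∀ t, 0 ≤ χ t) ∧
    ∀ᶠ t in 𝓝 1, χ t = 1 := by
  let b : ContDiffBump (1 : ℝ) := ⟨1 / 4, 1 / 2, by norm_num, by norm_num⟩
  refine ⟨b, ⟨b.contDiff, 1 / 2, 3 / 2, by norm_num, fun t ht => ?_⟩, fun t => b.nonneg,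
    b.eventuallyEq_one⟩
  refine b.zero_of_le_dist ?_
  change 1 / 2 ≤ dist t 1
  rw [Real.dist_eq]
  by_contra hc
  rw [not_le, abs_lt] at hc
  exact ht ⟨by linarith [hc.1], by linarith [hc.2]⟩

/-- The function `cutFun χ f` as a real Schwartz function. -/
def cutSchwartzReal {χ : ℝ → ℝ} (h : IsRadialCutoff χ) (f : SmoothS2) : SchwartzMap E3 ℝ :=
  (h.hasCompactSupport_cutFun f).toSchwartzMap (h.contDiff_cutFun f)

theorem integrable_sphere (f : SmoothS2) : Integrable f surfaceMeasure :=
  f.contMDiff.continuous.integrable_of_hasCompactSupport (HasCompactSupport.of_compactSpace _)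

/-- **Green's formula** on the sphere. It follows from the symmetry of the Euclidean Laplacian on
the functions `cutFun χ f`, whose Laplacian separates in polar coordinates. -/
theorem integral_mul_sphereLaplacian (f g : SmoothS2) :
    ∫ x, f x * sphereLaplacian g x ∂surfaceMeasure =
      ∫ x, sphereLaplacian f x * g x ∂surfaceMeasure := by
  obtain ⟨χ, hχ, h0, h1⟩ := exists_isRadialCutoff
  -- The first summand is symmetric in `f` and `g`, so that the second one has to be symmetric, too.
  have key : ∀ f g : SmoothS2, ∫ y, cutFun χ f y * Δ (cutFun χ g) y =
      radialMass (fun t => χ t * radialLaplacian χ t) * ∫ x, f x * g x ∂surfaceMeasure +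
      radialMass (fun t => χ t * (t⁻¹ * χ t)) *
        ∫ x, f x * sphereLaplacian g x ∂surfaceMeasure := by
    intro f g
    rw [← integral_cutFun_mul_cutFun, ← integral_cutFun_mul_cutFun, ← integral_add]
    · congr 1
      funext y
      rw [laplacian_cutFun hχ, mul_add]
    · exact (((hχ.contDiff_cutFun f).continuous.mul
        (hχ.radialLaplacian.contDiff_cutFun g).continuous)).integrable_of_hasCompactSupport
          ((hχ.hasCompactSupport_cutFun f).mul_right)
    · have hg := (hχ.inv_mul.contDiff_cutFun (sphereLaplacian g)).continuous
      exact ((hχ.contDiff_cutFun f).continuous.mul hg).integrable_of_hasCompactSupport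
        ((hχ.hasCompactSupport_cutFun f).mul_right)
  have hsymm : ∫ y, cutFun χ f y * Δ (cutFun χ g) y = ∫ y, cutFun χ g y * Δ (cutFun χ f) y := by
    have h := SchwartzMap.integral_mul_laplacian_right_eq_left (μ := volume)
      (cutSchwartzReal hχ f) (cutSchwartzReal hχ g)
    simp only [SchwartzMap.laplacian_apply] at h
    rw [show (∫ y, cutFun χ g y * Δ (cutFun χ f) y) = ∫ y, Δ (cutFun χ f) y * cutFun χ g y by
      simp only [mul_comm]]
    exact h
  have hpos : 0 < radialMass (fun t => χ t * (t⁻¹ * χ t)) := by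
    refine radialMass_pos (hχ.inv_mul.mul_left fun _ _ => hχ.contDiff.contDiffAt) (fun t => ?_) ?_
    · rcases le_or_gt t 0 with ht | ht
      · obtain ⟨a, b, ha, hab⟩ := hχ.vanish
        rw [hab t fun h => (ht.trans_lt ha).not_ge h.1, zero_mul]
      · exact mul_nonneg (h0 t) (mul_nonneg (inv_pos.mpr ht).le (h0 t))
    · simp [h1.self_of_nhds]
  rw [key, key, show (∫ x, f x * g x ∂surfaceMeasure) = ∫ x, g x * f x ∂surfaceMeasure by
    simp only [mul_comm]] at hsymm
  rw [mul_left_cancel₀ hpos.ne' (add_left_cancel hsymm)]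
  simp only [mul_comm]

theorem sphereLaplacian_one : sphereLaplacian 1 = 0 := by
  ext x
  have h := sphereLaplacian_mul 1 1 x
  have h1 : radialExt (1 : SmoothS2) =ᶠ[𝓝 (x : E3)] fun _ => (1 : ℝ) := by
    filter_upwards [isOpen_compl_singleton.mem_nhds (sphere_ne_zero x)] with y hy
    have hy' : y ≠ 0 := hy
    simp [radialExt, hy']
  rw [h1.fderiv_eq] at h
  simp only [mul_one] at h
  simp at h
  simpa using h

/-- The Laplace–Beltrami operator is nonpositive: `Δ(f²)` has integral zero and equals
`2 f Δf + 2 |∇f|²`. -/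
theorem integral_mul_sphereLaplacian_self_nonpos (f : SmoothS2) :
    ∫ x, f x * sphereLaplacian f x ∂surfaceMeasure ≤ 0 := by
  have h := integral_mul_sphereLaplacian (f * f) 1
  rw [sphereLaplacian_one] at h
  have h1 : ∫ x, sphereLaplacian (f * f) x ∂surfaceMeasure = 0 := by simpa using h.symm
  have h2 : 2 * ∫ x, f x * sphereLaplacian f x ∂surfaceMeasure ≤
      ∫ x, sphereLaplacian (f * f) x ∂surfaceMeasure := by
    rw [← integral_const_mul]
    refine integral_mono ((integrable_sphere (f * sphereLaplacian f)).const_mul 2)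
      (integrable_sphere _) fun x => ?_
    change 2 * (f x * sphereLaplacian f x) ≤ sphereLaplacian (f * f) x
    rw [sphereLaplacian_mul]
    have : 0 ≤ ∑ i : Fin 3, fderiv ℝ (radialExt f) x (EuclideanSpace.single i 1) *
        fderiv ℝ (radialExt f) x (EuclideanSpace.single i 1) :=
      Finset.sum_nonneg fun i _ => mul_self_nonneg _
    linarith
  linarith

theorem inner_toL2 (f g : SmoothS2) :
    ⟪toL2 f, toL2 g⟫_ℝ = ∫ x, f x * g x ∂surfaceMeasure := by
  have hf : toL2 f =ᵐ[surfaceMeasure] f := ContinuousMap.coeFn_toLp surfaceMeasure _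
  have hg : toL2 g =ᵐ[surfaceMeasure] g := ContinuousMap.coeFn_toLp surfaceMeasure _
  rw [L2.inner_def]
  refine integral_congr_ae ?_
  filter_upwards [hf, hg] with x hx hx'
  rw [hx, hx']
  simp [mul_comm]

theorem norm_sq_toL2 (f : SmoothS2) : ‖toL2 f‖ ^ 2 = ∫ x, f x * f x ∂surfaceMeasure := by
  rw [← inner_toL2, real_inner_self_eq_norm_sq]

/-- The operator `-Δ + k` on the smooth functions on the sphere. -/
def smoothOp (k : ℝ) : Module.End ℝ SmoothS2 := -sphereLaplacian + k • LinearMap.id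

theorem smoothOp_apply (k : ℝ) (f : SmoothS2) : smoothOp k f = -sphereLaplacian f + k • f := rfl

theorem inner_sphereLaplacian (f g : SmoothS2) :
    ⟪toL2 (sphereLaplacian f), toL2 g⟫_ℝ = ⟪toL2 f, toL2 (sphereLaplacian g)⟫_ℝ := by
  rw [inner_toL2, inner_toL2, integral_mul_sphereLaplacian]

theorem inner_smoothOp (k : ℝ) (f g : SmoothS2) :
    ⟪toL2 (smoothOp k f), toL2 g⟫_ℝ = ⟪toL2 f, toL2 (smoothOp k g)⟫_ℝ := by
  simp only [smoothOp_apply, map_add, map_neg, map_smul, inner_add_left, inner_add_right,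
    inner_neg_left, inner_neg_right, real_inner_smul_left, real_inner_smul_right,
    inner_sphereLaplacian]

/-- As `-Δ` is nonnegative, the operator `-Δ + k` is bounded below by `k`, hence by one. -/
theorem norm_toL2_le_smoothOp {k : ℝ} (hk : 1 < k) (f : SmoothS2) :
    ‖toL2 f‖ ≤ ‖toL2 (smoothOp k f)‖ := by
  rcases (norm_nonneg (toL2 f)).eq_or_lt with h0 | h0
  · rw [← h0]
    exact norm_nonneg _
  have h1 : ‖toL2 f‖ ^ 2 ≤ ⟪toL2 f, toL2 (smoothOp k f)⟫_ℝ := by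
    rw [smoothOp_apply, map_add, map_neg, map_smul, inner_add_right, inner_neg_right,
      real_inner_smul_right, real_inner_self_eq_norm_sq, inner_toL2]
    nlinarith [integral_mul_sphereLaplacian_self_nonpos f, sq_nonneg ‖toL2 f‖]
  have h2 := h1.trans (real_inner_le_norm _ _)
  rw [sq] at h2
  exact le_of_mul_le_mul_left h2 h0

theorem norm_toL2_le_pow {k : ℝ} (hk : 1 < k) (f : SmoothS2) {m n : ℕ} (hmn : m ≤ n) :
    ‖toL2 ((smoothOp k ^ m) f)‖ ≤ ‖toL2 ((smoothOp k ^ n) f)‖ := by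
  induction n, hmn using Nat.le_induction with
  | base => exact le_rfl
  | succ n _ ih =>
    rw [pow_succ', Module.End.mul_apply]
    exact ih.trans (norm_toL2_le_smoothOp hk _)

end Green

/-! ### The elliptic estimate -/

section Elliptic

open scoped Laplacian
open MeasureTheory

/-- The function `cutFun χ f` as a complex Schwartz function. -/
def cutSchwartz {χ : ℝ → ℝ} (h : IsRadialCutoff χ) (f : SmoothS2) : SchwartzMap E3 ℂ :=
  ((h.hasCompactSupport_cutFun f).comp_left Complex.ofReal_zero).toSchwartzMap
    (Complex.ofRealCLM.contDiff.comp (h.contDiff_cutFun f))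

theorem cutSchwartz_apply {χ : ℝ → ℝ} (h : IsRadialCutoff χ) (f : SmoothS2) (y : E3) :
    cutSchwartz h f y = (cutFun χ f y : ℂ) := rfl

theorem coe_cutSchwartz {χ : ℝ → ℝ} (h : IsRadialCutoff χ) (f : SmoothS2) :
    (cutSchwartz h f : E3 → ℂ) = Complex.ofRealLI ∘ cutFun χ f := rfl

theorem laplacian_cutSchwartz {χ : ℝ → ℝ} (h : IsRadialCutoff χ) (f : SmoothS2) (y : E3) :
    Δ (cutSchwartz h f) y = ((Δ (cutFun χ f) y : ℝ) : ℂ) := by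
  rw [SchwartzMap.laplacian_apply]
  have hc : ContDiffAt ℝ 2 (cutFun χ f) y :=
    ((h.contDiff_cutFun f).of_le two_le_infty).contDiffAt
  exact hc.laplacian_CLM_comp_left (l := Complex.ofRealCLM)

theorem radialExt_smoothOp (k : ℝ) (f : SmoothS2) (y : E3) :
    radialExt (smoothOp k f) y = -radialExt (sphereLaplacian f) y + k * radialExt f y := by
  by_cases hy : y ≠ 0
  · simp [radialExt, hy, smoothOp_apply]
  · simp [radialExt, hy]

/-- The radial profile that multiplies `f` in `(1 - Δ) (cutFun χ f)`, once the Laplace–Beltrami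
operator is expressed by `-Δ + k`. -/
def ellipticProfile (k : ℝ) (χ : ℝ → ℝ) (t : ℝ) : ℝ :=
  χ t - radialLaplacian χ t - k * (t⁻¹ * χ t)

theorem IsRadialCutoff.ellipticProfile {χ : ℝ → ℝ} (h : IsRadialCutoff χ) (k : ℝ) :
    IsRadialCutoff (ellipticProfile k χ) :=
  (h.sub h.radialLaplacian).sub (h.inv_mul.mul_left (g := fun _ => k) fun _ _ => contDiffAt_const)

/-- The operator `1 - Δ` maps a cut-off extension of `f` to a sum of cut-off extensions of `f` and
of `(-Δ + k) f`; this makes induction on the power of `1 - Δ` possible. -/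
theorem oneSubLaplacian_cutSchwartz {χ : ℝ → ℝ} (h : IsRadialCutoff χ) (k : ℝ) (f : SmoothS2) :
    oneSubLaplacian (cutSchwartz h f) =
      cutSchwartz (h.ellipticProfile k) f + cutSchwartz h.inv_mul (smoothOp k f) := by
  ext y
  rw [oneSubLaplacian, sub_apply, add_apply, laplacian_cutSchwartz, laplacian_cutFun h]
  simp only [cutSchwartz_apply]
  norm_cast
  simp only [cutFun, BMS.ellipticProfile, radialExt_smoothOp]
  ring

theorem iterate_oneSubLaplacian_add (m : ℕ) (F G : SchwartzMap E3 ℂ) :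
    oneSubLaplacian^[m] (F + G) = oneSubLaplacian^[m] F + oneSubLaplacian^[m] G := by
  induction m generalizing F G with
  | zero => rfl
  | succ m ih =>
    have h : oneSubLaplacian (F + G) = oneSubLaplacian F + oneSubLaplacian G := by
      have := (LineDeriv.laplacianCLM ℝ E3 (SchwartzMap E3 ℂ)).map_add F G
      simp only [SchwartzMap.laplacianCLM_eq'] at this
      simp only [oneSubLaplacian, this]
      abel
    simp only [Function.iterate_succ_apply, h, ih]

theorem norm_toLp_two (F : SchwartzMap E3 ℂ) :
    ‖F.toLp 2 (volume : Measure E3)‖ = Real.sqrt (∫ y, ‖F y‖ ^ 2) := by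
  have h : ‖F.toLp 2 (volume : Measure E3)‖ ^ 2 = ∫ y, ‖F y‖ ^ 2 := by
    have h1 := L2.inner_def (𝕜 := ℂ) (F.toLp 2 (volume : Measure E3)) (F.toLp 2 volume)
    rw [inner_self_eq_norm_sq_to_K] at h1
    have h2 : ∫ y, ⟪(F.toLp 2 (volume : Measure E3)) y, (F.toLp 2 (volume : Measure E3)) y⟫_ℂ =
        ∫ y, ((‖F y‖ ^ 2 : ℝ) : ℂ) := by
      refine integral_congr_ae ?_
      filter_upwards [F.coeFn_toLp 2 (volume : Measure E3)] with y hy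
      rw [hy, inner_self_eq_norm_sq_to_K]
      push_cast
      rfl
    rw [h2, integral_complex_ofReal] at h1
    exact Complex.ofReal_injective ((Complex.ofReal_pow _ _).trans h1)
  rw [← h, Real.sqrt_sq (norm_nonneg _)]

theorem norm_cutSchwartz_toLp {χ : ℝ → ℝ} (h : IsRadialCutoff χ) (f : SmoothS2) :
    ‖(cutSchwartz h f).toLp 2 (volume : Measure E3)‖ =
      Real.sqrt (radialMass (fun t => χ t * χ t)) * ‖toL2 f‖ := by
  rw [norm_toLp_two]
  have h1 : ∫ y, ‖cutSchwartz h f y‖ ^ 2 =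
      radialMass (fun t => χ t * χ t) * ‖toL2 f‖ ^ 2 := by
    rw [norm_sq_toL2, ← integral_cutFun_mul_cutFun]
    congr 1
    funext y
    rw [cutSchwartz_apply, Complex.norm_real, Real.norm_eq_abs, sq_abs, sq]
  rw [h1, Real.sqrt_mul' _ (sq_nonneg _), Real.sqrt_sq (norm_nonneg _)]

/-- The induction needs the estimate for all radial cut-offs, because `1 - Δ` changes them. -/
theorem exists_norm_iterate_cutSchwartz_le {k : ℝ} (hk : 1 < k) (m : ℕ) {χ : ℝ → ℝ}
    (h : IsRadialCutoff χ) : ∃ C : ℝ, 0 ≤ C ∧ ∀ f : SmoothS2,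
      ‖(oneSubLaplacian^[m] (cutSchwartz h f)).toLp 2 (volume : Measure E3)‖ ≤
        C * ‖toL2 ((smoothOp k ^ m) f)‖ := by
  induction m generalizing χ with
  | zero =>
    exact ⟨_, Real.sqrt_nonneg _, fun f => (norm_cutSchwartz_toLp h f).le⟩
  | succ m ih =>
    obtain ⟨C₁, hC₁, h₁⟩ := ih (h.ellipticProfile k)
    obtain ⟨C₂, hC₂, h₂⟩ := ih h.inv_mul
    refine ⟨C₁ + C₂, add_nonneg hC₁ hC₂, fun f => ?_⟩
    rw [Function.iterate_succ_apply, oneSubLaplacian_cutSchwartz h k, iterate_oneSubLaplacian_add]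
    have hadd : ∀ F G : SchwartzMap E3 ℂ, (F + G).toLp 2 (volume : Measure E3) =
        F.toLp 2 volume + G.toLp 2 volume := fun F G =>
      (SchwartzMap.toLpCLM ℂ ℂ 2 (volume : Measure E3)).map_add F G
    rw [hadd, add_mul]
    refine (norm_add_le _ _).trans (add_le_add ((h₁ f).trans ?_) ((h₂ _).trans (le_of_eq ?_)))
    · exact mul_le_mul_of_nonneg_left (norm_toL2_le_pow hk f (Nat.le_succ m)) hC₁
    · rw [pow_succ, Module.End.mul_apply]

/-- The **elliptic estimate**: the derivatives of order `n` of a cut-off radially constant extension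
are bounded uniformly by the `L²` norm of `(-Δ + k) ^ (n + 1)` applied to the function. -/
theorem exists_norm_iteratedFDeriv_cutFun_le {k : ℝ} (hk : 1 < k) {χ : ℝ → ℝ}
    (h : IsRadialCutoff χ) (n : ℕ) : ∃ C : ℝ, 0 ≤ C ∧ ∀ (f : SmoothS2) (y : E3),
      ‖iteratedFDeriv ℝ n (cutFun χ f) y‖ ≤ C * ‖toL2 ((smoothOp k ^ (n + 1)) f)‖ := by
  obtain ⟨K, hK, hS⟩ := exists_norm_iteratedFDeriv_le
  obtain ⟨C, hC, h1⟩ := exists_norm_iterate_cutSchwartz_le hk (n + 1) h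
  refine ⟨K * C, mul_nonneg hK hC, fun f y => ?_⟩
  have h2 : ‖iteratedFDeriv ℝ n (cutSchwartz h f) y‖ = ‖iteratedFDeriv ℝ n (cutFun χ f) y‖ := by
    rw [coe_cutSchwartz]
    exact Complex.ofRealLI.norm_iteratedFDeriv_comp_left
      (h.contDiff_cutFun f).contDiffAt (by exact_mod_cast le_top)
  rw [← h2, mul_assoc]
  refine (hS n _ y).trans (mul_le_mul_of_nonneg_left ?_ hK)
  rw [← norm_toLp_two]
  exact h1 f

/-- The elliptic estimate on the sphere itself. -/
theorem exists_norm_iteratedFDeriv_radialExt_le {k : ℝ} (hk : 1 < k) (n : ℕ) :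
    ∃ C : ℝ, 0 ≤ C ∧ ∀ (f : SmoothS2) (x : S2),
      ‖iteratedFDeriv ℝ n (radialExt f) x‖ ≤ C * ‖toL2 ((smoothOp k ^ (n + 1)) f)‖ := by
  obtain ⟨χ, hχ, -, h1⟩ := exists_isRadialCutoff
  obtain ⟨C, hC, h2⟩ := exists_norm_iteratedFDeriv_cutFun_le hk hχ n
  refine ⟨C, hC, fun f x => ?_⟩
  have hc : Filter.Tendsto (fun z : E3 => ‖z‖ ^ 2) (𝓝 (x : E3)) (𝓝 1) := by
    have : ContinuousAt (fun z : E3 => ‖z‖ ^ 2) (x : E3) := (continuous_norm.pow 2).continuousAt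
    simpa [ContinuousAt, mem_sphere_zero_iff_norm.mp x.2] using this
  have h3 : cutFun χ f =ᶠ[𝓝 (x : E3)] radialExt f := by
    filter_upwards [hc.eventually h1] with y hy
    simp [cutFun, hy]
  rw [← (h3.iteratedFDeriv ℝ n).eq_of_nhds]
  exact h2 f x

end Elliptic

/-! ### Limits of smooth functions -/

section Limit

open Filter

/-- A sequence of smooth functions all of whose derivatives are uniformly Cauchy converges to a
smooth function. -/
theorem exists_contDiff_tendsto {E : Type*} [NormedAddCommGroup E] [NormedSpace ℝ E]
    {F : ℕ → E → ℝ} (hF : ∀ N, ContDiff ℝ ∞ (F N))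
    (hC : ∀ n : ℕ, UniformCauchySeqOn (fun N => iteratedFDeriv ℝ n (F N)) atTop Set.univ) :
    ∃ G : E → ℝ, ContDiff ℝ ∞ G ∧ TendstoUniformly F G atTop := by
  have hlim : ∀ n x, ∃ L, Tendsto (fun N => iteratedFDeriv ℝ n (F N) x) atTop (𝓝 L) := fun n x =>
    cauchySeq_tendsto_of_complete ((hC n).cauchySeq (Set.mem_univ x))
  choose P hP using hlim
  have hU : ∀ n, TendstoUniformly (fun N => iteratedFDeriv ℝ n (F N)) (P n) atTop := fun n =>
    tendstoUniformlyOn_univ.mp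
      ((hC n).tendstoUniformlyOn_of_tendsto fun x _ => hP n x)
  have hd : ∀ (n : ℕ) (x : E), HasFDerivAt (P n) (P (n + 1) x).curryLeft x := by
    intro n
    refine hasFDerivAt_of_tendstoUniformly (f := fun N => iteratedFDeriv ℝ n (F N))
      (f' := fun N x => (iteratedFDeriv ℝ (n + 1) (F N) x).curryLeft) (l := atTop) ?_ ?_ (hP n)
    · have hc := (continuousMultilinearCurryLeftEquiv ℝ (fun _ : Fin (n + 1) => E) ℝ).isometry
      exact hc.uniformContinuous.comp_tendstoUniformly (hU (n + 1))
    · intro N x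
      exact (contDiff_iff_ftaylorSeries.mp (hF N)).fderiv n
        (by exact_mod_cast ENat.natCast_lt_top n) x
  refine ⟨fun x => (P 0 x).curry0, ?_, ?_⟩
  · have hT : HasFTaylorSeriesUpTo ∞ (fun x => (P 0 x).curry0) (fun x n => P n x) :=
      ⟨fun _ => rfl, fun n _ => hd n,
        fun n _ => continuous_iff_continuousAt.mpr fun x => (hd n x).continuousAt⟩
    exact hT.contDiff
  · exact (continuousMultilinearCurryFin0 ℝ E ℝ).isometry.uniformContinuous.comp_tendstoUniformly
      (hU 0)

end Limit

/-! ### Polynomials on the sphere -/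

section Polynomials

/-- The restriction to the sphere of a linear coordinate. -/
def coord (i : Fin 3) : SmoothS2 :=
  ⟨fun x => (x : E3) i, by
    have : Fact (Module.finrank ℝ E3 = 2 + 1) := ⟨by simp⟩
    exact (EuclideanSpace.proj (𝕜 := ℝ) i).contDiff.contMDiff.comp (contMDiff_coe_sphere (n := 2))⟩

theorem coord_apply (i : Fin 3) (x : S2) : coord i x = (x : E3) i := rfl

theorem norm_sq_sphere (x : S2) : ‖(x : E3)‖ ^ 2 = 1 := by
  rw [mem_sphere_zero_iff_norm.mp x.2, one_pow]

/-- The power of `‖y‖ ^ 2`, rather than `‖y‖⁻¹`, fits the formulas for radial functions. -/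
theorem radialExt_coord (i : Fin 3) (x : S2) :
    radialExt (coord i) =ᶠ[𝓝 (x : E3)] fun y => y i * (‖y‖ ^ 2) ^ (-1 / 2 : ℝ) := by
  filter_upwards [isOpen_compl_singleton.mem_nhds (sphere_ne_zero x)] with y hy
  have hy' : y ≠ 0 := hy
  rw [radialExt, dif_pos hy', coord_apply]
  have : (‖y‖ ^ 2) ^ (-1 / 2 : ℝ) = ‖y‖⁻¹ := by
    rw [← Real.rpow_natCast, ← Real.rpow_mul (norm_nonneg y)]
    norm_num
    rw [Real.rpow_neg_one]
  rw [this, mul_comm]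
  simp [radialProj]

theorem contDiffAt_rpow_one (p : ℝ) : ContDiffAt ℝ 2 (fun t : ℝ => t ^ p) 1 :=
  Real.contDiffAt_rpow_const_of_ne one_ne_zero

theorem deriv_rpow_near_one (p : ℝ) :
    deriv (fun t : ℝ => t ^ p) =ᶠ[𝓝 1] fun t => p * t ^ (p - 1) := by
  filter_upwards [lt_mem_nhds (zero_lt_one' ℝ)] with t ht
  exact Real.deriv_rpow_const _ _

theorem fderiv_radialExt_coord (i : Fin 3) (x : S2) (v : E3) :
    fderiv ℝ (radialExt (coord i)) x v = v i - (x : E3) i * ⟪(x : E3), v⟫_ℝ := by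
  have h1 := norm_sq_sphere x
  have hd : DifferentiableAt ℝ (fun t : ℝ => t ^ (-1 / 2 : ℝ)) (‖(x : E3)‖ ^ 2) := by
    rw [h1]
    exact (contDiffAt_rpow_one _).differentiableAt (by simp)
  have h2 := hasFDerivAt_comp_norm_sq hd
  have h3 : HasFDerivAt (fun y : E3 => y i) (EuclideanSpace.proj (𝕜 := ℝ) i) (x : E3) :=
    (EuclideanSpace.proj (𝕜 := ℝ) i).hasFDerivAt
  rw [(radialExt_coord i x).fderiv_eq, (h3.fun_mul h2).fderiv, h1,
    (deriv_rpow_near_one _).self_of_nhds]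
  simp
  ring

theorem sphereLaplacian_coord (i : Fin 3) : sphereLaplacian (coord i) = (-2 : ℝ) • coord i := by
  ext x
  have h1 := norm_sq_sphere x
  have hc : ContDiffAt ℝ 2 (fun t : ℝ => t ^ (-1 / 2 : ℝ)) (‖(x : E3)‖ ^ 2) := by
    rw [h1]
    exact contDiffAt_rpow_one _
  have hp : ContDiffAt ℝ 2 (fun y : E3 => y i) (x : E3) :=
    (EuclideanSpace.proj (𝕜 := ℝ) i).contDiff.contDiffAt
  have hc' : ContDiffAt ℝ 2 (fun y : E3 => (‖y‖ ^ 2) ^ (-1 / 2 : ℝ)) (x : E3) :=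
    ContDiffAt.comp (g := fun t : ℝ => t ^ (-1 / 2 : ℝ)) (x : E3) hc
      (contDiff_norm_sq ℝ).contDiffAt
  have hp' : fderiv ℝ (fun y : E3 => y i) = fun _ => EuclideanSpace.proj (𝕜 := ℝ) i := by
    funext y
    exact (EuclideanSpace.proj (𝕜 := ℝ) i).hasFDerivAt.fderiv
  have hl : Laplacian.laplacian (fun y : E3 => y i) (x : E3) = 0 := by
    rw [laplacian_eq_sum_fderiv, hp']
    simp
  have h2 := hasFDerivAt_comp_norm_sq (hc.differentiableAt (by simp))
  have hdd : deriv (deriv (fun t : ℝ => t ^ (-1 / 2 : ℝ))) 1 = 3 / 4 := by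
    rw [(deriv_rpow_near_one _).deriv_eq, deriv_const_mul_field,
      (deriv_rpow_near_one _).self_of_nhds]
    norm_num
  change Laplacian.laplacian (radialExt (coord i)) (x : E3) = (-2 : ℝ) * (x : E3) i
  rw [(InnerProductSpace.laplacian_congr_nhds (radialExt_coord i x)).eq_of_nhds,
    laplacian_mul hp hc', hl, laplacian_comp_norm_sq hc, hp', h2.fderiv, h1, hdd,
    (deriv_rpow_near_one _).self_of_nhds]
  fin_cases i <;> simp [EuclideanSpace.inner_single_right] <;> ring

/-- The `i`-th component of the tangential gradient. It is defined through the commutator of the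
Laplace–Beltrami operator with the `i`-th coordinate, so that its smoothness is automatic. -/
def angularGrad (i : Fin 3) : SmoothS2 →ₗ[ℝ] SmoothS2 :=
  (1 / 2 : ℝ) • (sphereLaplacian ∘ₗ LinearMap.mulLeft ℝ (coord i) -
    LinearMap.mulLeft ℝ (coord i) ∘ₗ sphereLaplacian + (2 : ℝ) • LinearMap.mulLeft ℝ (coord i))

theorem sphereLaplacian_coord_mul (i : Fin 3) (g : SmoothS2) :
    sphereLaplacian (coord i * g) =
      coord i * sphereLaplacian g - (2 : ℝ) • (coord i * g) + (2 : ℝ) • angularGrad i g := by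
  ext x
  have h : angularGrad i g x = 1 / 2 * (sphereLaplacian (coord i * g) x -
    coord i x * sphereLaplacian g x + 2 * (coord i x * g x)) := rfl
  change sphereLaplacian (coord i * g) x = coord i x * sphereLaplacian g x -
    2 * (coord i x * g x) + 2 * angularGrad i g x
  rw [h]
  ring

/-- The radially constant extension has no radial derivative, so its Euclidean gradient is the
tangential one. -/
theorem angularGrad_apply (i : Fin 3) (g : SmoothS2) (x : S2) :
    angularGrad i g x = fderiv ℝ (radialExt g) x (EuclideanSpace.single i 1) := by
  have h1 : ∑ j : Fin 3, fderiv ℝ (radialExt (coord i)) x (EuclideanSpace.single j 1) *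
      fderiv ℝ (radialExt g) x (EuclideanSpace.single j 1) =
      fderiv ℝ (radialExt g) x (EuclideanSpace.single i 1) := by
    have h6 := fderiv_radialExt_self g (sphere_ne_zero x)
    rw [apply_eq_sum_single, Fin.sum_univ_three] at h6
    simp only [fderiv_radialExt_coord, Fin.sum_univ_three, EuclideanSpace.inner_single_right]
    fin_cases i <;> simp <;> linear_combination (-(x : E3) _) * h6
  have h2 := congrArg (fun f : SmoothS2 => f x) (sphereLaplacian_coord_mul i g)
  have h3 := sphereLaplacian_mul (coord i) g x
  rw [h1, sphereLaplacian_coord] at h3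
  have h4 : sphereLaplacian (coord i * g) x = coord i x * sphereLaplacian g x -
    2 * (coord i x * g x) + 2 * angularGrad i g x := h2
  have h5 : ((-2 : ℝ) • coord i) x = -2 * coord i x := rfl
  rw [h5] at h3
  linarith

theorem angularGrad_coord_mul (i j : Fin 3) (g : SmoothS2) :
    angularGrad j (coord i * g) =
      coord i * angularGrad j g + (if i = j then g else 0) - coord i * (coord j * g) := by
  ext x
  have hf := (contDiffAt_radialExt (coord i) (sphere_ne_zero x)).differentiableAt (by simp)
  have hg := (contDiffAt_radialExt g (sphere_ne_zero x)).differentiableAt (by simp)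
  have h1 : radialExt (coord i * g : SmoothS2) = fun y => radialExt (coord i) y * radialExt g y :=
    radialExt_mul (coord i) g
  have h2 : (coord i * angularGrad j g + (if i = j then g else 0) - coord i * (coord j * g)) x =
      coord i x * angularGrad j g x + (if i = j then g x else 0) -
        coord i x * (coord j x * g x) := by
    split_ifs <;> rfl
  rw [h2, angularGrad_apply, angularGrad_apply, h1, fderiv_fun_mul hf hg]
  simp only [add_apply, smul_apply, fderiv_radialExt_coord, radialExt_apply_sphere, smul_eq_mul,
    EuclideanSpace.inner_single_right, coord_apply]
  split_ifs with h
  · subst h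
    simp
    ring
  · simp [h]
    ring

/-- The restrictions to the sphere of the polynomials of degree at most `n`. -/
def polySpace : ℕ → Submodule ℝ SmoothS2
  | 0 => Submodule.span ℝ {1}
  | n + 1 => polySpace n ⊔ ⨆ i : Fin 3, (polySpace n).map (LinearMap.mulLeft ℝ (coord i))

theorem polySpace_mono : Monotone polySpace :=
  monotone_nat_of_le_succ fun _ => le_sup_left

theorem coord_mul_mem {n : ℕ} {g : SmoothS2} (hg : g ∈ polySpace n) (i : Fin 3) :
    coord i * g ∈ polySpace (n + 1) :=
  (le_sup_right : _ ≤ polySpace (n + 1))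
    (le_iSup (fun i : Fin 3 => (polySpace n).map (LinearMap.mulLeft ℝ (coord i))) i
      (Submodule.mem_map_of_mem hg))

theorem polySpace_succ_le {n : ℕ} {W : Submodule ℝ SmoothS2} (h0 : polySpace n ≤ W)
    (h1 : ∀ i, ∀ g ∈ polySpace n, coord i * g ∈ W) : polySpace (n + 1) ≤ W := by
  refine sup_le h0 (iSup_le fun i => ?_)
  rw [Submodule.map_le_iff_le_comap]
  exact h1 i

instance finiteDimensional_polySpace (n : ℕ) : FiniteDimensional ℝ (polySpace n) := by
  induction n with
  | zero =>
    rw [polySpace]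
    infer_instance
  | succ n ih =>
    rw [polySpace]
    infer_instance

theorem angularGrad_one (j : Fin 3) : angularGrad j 1 = 0 := by
  have h1 : sphereLaplacian (coord j * 1) = (-2 : ℝ) • coord j := by
    rw [mul_one, sphereLaplacian_coord]
  rw [sphereLaplacian_coord_mul, sphereLaplacian_one, mul_zero, mul_one, zero_sub, ← neg_smul,
    add_eq_left] at h1
  exact (smul_eq_zero.mp h1).resolve_left two_ne_zero

/-- The tangential gradient raises the degree by at most one: that of the coordinate `xⱼ` has the
quadratic part `-xⱼ x`. -/
theorem angularGrad_mem (j : Fin 3) (n : ℕ) :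
    ∀ g ∈ polySpace n, angularGrad j g ∈ polySpace (n + 1) := by
  induction n with
  | zero =>
    change polySpace 0 ≤ (polySpace 1).comap (angularGrad j)
    rw [polySpace, Submodule.span_singleton_le_iff_mem, Submodule.mem_comap, angularGrad_one]
    exact zero_mem _
  | succ n ih =>
    change polySpace (n + 1) ≤ (polySpace (n + 2)).comap (angularGrad j)
    refine polySpace_succ_le (fun g hg => polySpace_mono (Nat.le_succ _) (ih g hg))
      fun i g hg => ?_
    rw [Submodule.mem_comap, angularGrad_coord_mul]
    refine sub_mem (add_mem (coord_mul_mem (ih g hg) i) ?_)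
      (coord_mul_mem (coord_mul_mem hg j) i)
    split_ifs
    · exact polySpace_mono (by omega) hg
    · exact zero_mem _

/-- The polynomials of degree at most `n` are invariant: by the product rule,
`Δ(xᵢ g) = xᵢ Δg - 2 xᵢ g + 2 (∇g)ᵢ`. -/
theorem sphereLaplacian_mem (n : ℕ) :
    ∀ g ∈ polySpace n, sphereLaplacian g ∈ polySpace n := by
  induction n with
  | zero =>
    change polySpace 0 ≤ (polySpace 0).comap sphereLaplacian
    rw [polySpace, Submodule.span_singleton_le_iff_mem, Submodule.mem_comap, sphereLaplacian_one]
    exact zero_mem _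
  | succ n ih =>
    change polySpace (n + 1) ≤ (polySpace (n + 1)).comap sphereLaplacian
    refine polySpace_succ_le (fun g hg => polySpace_mono (Nat.le_succ _) (ih g hg))
      fun i g hg => ?_
    rw [Submodule.mem_comap, sphereLaplacian_coord_mul]
    exact add_mem (sub_mem (coord_mul_mem (ih g hg) i)
      (Submodule.smul_mem _ _ (coord_mul_mem hg i)))
      (Submodule.smul_mem _ _ (angularGrad_mem i n g hg))

theorem smoothOp_mem (k : ℝ) {n : ℕ} {g : SmoothS2} (hg : g ∈ polySpace n) :
    smoothOp k g ∈ polySpace n := by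
  rw [smoothOp_apply]
  exact add_mem (neg_mem (sphereLaplacian_mem n g hg)) (Submodule.smul_mem _ _ hg)

/-- A smooth function on the sphere as a continuous function. -/
def toContinuous : SmoothS2 →ₗ[ℝ] C(S2, ℝ) where
  toFun f := ⟨f, f.contMDiff.continuous⟩
  map_add' _ _ := rfl
  map_smul' _ _ := rfl

/-- The algebra generated by the coordinates consists of polynomials. -/
theorem adjoin_coord_le :
    Subalgebra.toSubmodule (Algebra.adjoin ℝ (Set.range fun i => toContinuous (coord i))) ≤
      (⨆ n, polySpace n).map toContinuous := by
  rw [Algebra.adjoin_eq_span, Submodule.span_le]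
  intro m hm
  induction hm using Submonoid.closure_induction_left with
  | one =>
    exact ⟨1, le_iSup polySpace 0 (Submodule.mem_span_singleton_self _), rfl⟩
  | mul_left a ha y _ ih =>
    obtain ⟨i, rfl⟩ := ha
    obtain ⟨f, hf, rfl⟩ := ih
    obtain ⟨n, hn⟩ := (Submodule.mem_iSup_of_directed _ polySpace_mono.directed_le).mp hf
    exact ⟨coord i * f, le_iSup polySpace (n + 1) (coord_mul_mem hn i), rfl⟩

/-- By the Stone–Weierstrass theorem the polynomials are dense in `L²`. -/
theorem dense_polySpace :
    ⊤ ≤ (⨆ n, (polySpace n).map toL2).topologicalClosure := by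
  have hsep : (Algebra.adjoin ℝ (Set.range fun i => toContinuous (coord i))).SeparatesPoints := by
    intro x y hxy
    by_contra hc
    push Not at hc
    refine hxy (Subtype.ext ?_)
    ext i
    exact hc _ ⟨_, Algebra.subset_adjoin ⟨i, rfl⟩, rfl⟩
  have h1 := ContinuousMap.subalgebra_topologicalClosure_eq_top_of_separatesPoints _ hsep
  have h2 : Dense ((Algebra.adjoin ℝ (Set.range fun i => toContinuous (coord i)) :
      Subalgebra ℝ C(S2, ℝ)) : Set C(S2, ℝ)) := by
    rw [dense_iff_closure_eq, ← Subalgebra.topologicalClosure_coe, h1]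
    rfl
  have h3 := (ContinuousMap.toLp_denseRange ℝ surfaceMeasure ℝ
    (p := 2) (by simp)).dense_image (ContinuousLinearMap.continuous _) h2
  rw [← Submodule.map_iSup]
  intro x _
  refine closure_mono ?_ (h3 x)
  rintro _ ⟨f, hf, rfl⟩
  obtain ⟨g, hg, rfl⟩ := adjoin_coord_le hf
  exact ⟨g, hg, rfl⟩

end Polynomials

/-! ### Symmetric operators with many finite-dimensional invariant subspaces -/

theorem mem_graph_opPow_zero {H : Type*} [AddCommGroup H] [Module ℝ H] (A : H →ₗ.[ℝ] H)
    {x y : H} : (x, y) ∈ (opPow A 0).graph ↔ x = y := by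
  rw [LinearPMap.mem_graph_iff]
  constructor
  · rintro ⟨z, hz, hz'⟩
    exact hz.symm.trans hz'
  · rintro rfl
    exact ⟨⟨x, Submodule.mem_top⟩, rfl, rfl⟩

theorem mem_graph_opPow_succ {H : Type*} [AddCommGroup H] [Module ℝ H] (A : H →ₗ.[ℝ] H) (p : ℕ)
    {x y : H} : (x, y) ∈ (opPow A (p + 1)).graph ↔
      ∃ z, (x, z) ∈ (opPow A p).graph ∧ (z, y) ∈ A.graph := by
  simp only [LinearPMap.mem_graph_iff]
  constructor
  · rintro ⟨⟨w, hw⟩, rfl, hw'⟩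
    obtain ⟨⟨v, hv, hvw⟩, hw2⟩ := hw
    have hwp : w ∈ (opPow A p).domain := hw2
    have hv' : v = ⟨w, hwp⟩ := Subtype.ext hvw
    subst hv'
    exact ⟨opPow A p ⟨w, hwp⟩, ⟨⟨w, hwp⟩, rfl, rfl⟩, ⟨opPow A p ⟨w, hwp⟩, hv⟩, rfl, hw'⟩
  · rintro ⟨z, ⟨⟨w, hw⟩, rfl, rfl⟩, ⟨u, hu, hu'⟩⟩
    have hmem : opPow A p ⟨w, hw⟩ ∈ A.domain := by
      rw [← hu]
      exact u.2
    have hu2 : u = ⟨opPow A p ⟨w, hw⟩, hmem⟩ := Subtype.ext hu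
    subst hu2
    exact ⟨⟨w, ⟨⟨w, hw⟩, hmem, rfl⟩, hw⟩, rfl, hu'⟩

section Symmetric

variable {H D : Type*} [NormedAddCommGroup H] [InnerProductSpace ℝ H] [AddCommGroup D] [Module ℝ D]

/-- The closure of the graph of an operator `T`, defined on a space `D` that is mapped to a Hilbert
space by `ι`. -/
def closedGraph (ι : D →ₗ[ℝ] H) (T : Module.End ℝ D) : Submodule ℝ (H × H) :=
  (LinearMap.range (ι.prod (ι ∘ₗ T))).topologicalClosure

variable {ι : D →ₗ[ℝ] H} {T : Module.End ℝ D}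

theorem mem_closedGraph (f : D) : (ι f, ι (T f)) ∈ closedGraph ι T :=
  Submodule.le_topologicalClosure _ ⟨f, rfl⟩

theorem isClosed_closedGraph : IsClosed (closedGraph ι T : Set (H × H)) :=
  Submodule.isClosed_topologicalClosure _

/-- An identity between continuous functions on the graph of `T` extends to the closure. -/
theorem closedGraph_induction {P : H × H → Prop} (hP : IsClosed {z | P z})
    (h : ∀ f, P (ι f, ι (T f))) {z : H × H} (hz : z ∈ closedGraph ι T) : P z := by
  refine closure_minimal (s := (LinearMap.range (ι.prod (ι ∘ₗ T)) : Set (H × H))) ?_ hP hz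
  rintro _ ⟨f, rfl⟩
  exact h f

variable (hsymm : ∀ f g, ⟪ι (T f), ι g⟫_ℝ = ⟪ι f, ι (T g)⟫_ℝ)

include hsymm in
/-- Symmetry passes to the closure. -/
theorem inner_eq_of_mem_closedGraph {z w : H × H} (hz : z ∈ closedGraph ι T)
    (hw : w ∈ closedGraph ι T) : ⟪z.2, w.1⟫_ℝ = ⟪z.1, w.2⟫_ℝ := by
  refine closedGraph_induction (P := fun z => ⟪z.2, w.1⟫_ℝ = ⟪z.1, w.2⟫_ℝ)
    (isClosed_eq (by fun_prop) (by fun_prop)) (fun f => ?_) hz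
  exact closedGraph_induction (P := fun w => ⟪ι (T f), w.1⟫_ℝ = ⟪ι f, w.2⟫_ℝ)
    (isClosed_eq (by fun_prop) (by fun_prop)) (fun g => hsymm f g) hw

variable {V : ℕ → Submodule ℝ D} (hdense : ⊤ ≤ (⨆ n, (V n).map ι).topologicalClosure)

include hdense in
theorem dense_range_of_dense : Dense (LinearMap.range ι : Set H) := by
  intro x
  refine closure_mono ?_ (hdense (Submodule.mem_top (x := x)))
  exact iSup_le fun n => LinearMap.map_le_range

include hsymm hdense in
/-- A densely defined symmetric operator is closable. -/
theorem graph_closedGraph : (closedGraph ι T).toLinearPMap.graph = closedGraph ι T := by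
  refine Submodule.toLinearPMap_graph_eq _ fun z hz hz0 => ?_
  refine (dense_range_of_dense hdense).eq_zero_of_inner_left ℝ ?_
  rintro _ ⟨g, rfl⟩
  have h := inner_eq_of_mem_closedGraph hsymm hz (mem_closedGraph g)
  rw [hz0, inner_zero_left] at h
  exact h

include hsymm hdense in
theorem mem_graph_opPow_smooth (p : ℕ) (f : D) :
    (ι f, ι ((T ^ p) f)) ∈ (opPow (closedGraph ι T).toLinearPMap p).graph := by
  induction p with
  | zero => exact (mem_graph_opPow_zero _).mpr rfl
  | succ p ih =>
    refine (mem_graph_opPow_succ _ p).mpr ⟨_, ih, ?_⟩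
    rw [graph_closedGraph hsymm hdense, pow_succ', Module.End.mul_apply]
    exact mem_closedGraph _

variable [∀ n, FiniteDimensional ℝ (V n)] (hinv : ∀ n, ∀ v ∈ V n, T v ∈ V n)

theorem exists_lift_starProjection (x : H) (n : ℕ) :
    ∃ v ∈ V n, ι v = ((V n).map ι).starProjection x :=
  ((V n).map ι).starProjection_apply_mem x

include hinv in
/-- The orthogonal projections to the invariant subspaces commute with the operator, even with the
weak formulation of the operator. -/
theorem starProjection_eq_of_weak {x y : H} (hxy : ∀ g, ⟪y, ι g⟫_ℝ = ⟪x, ι (T g)⟫_ℝ)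
    (hsymm : ∀ f g, ⟪ι (T f), ι g⟫_ℝ = ⟪ι f, ι (T g)⟫_ℝ)
    {n : ℕ} {v : D} (hv : v ∈ V n) (hvx : ι v = ((V n).map ι).starProjection x) :
    ι (T v) = ((V n).map ι).starProjection y := by
  refine (Submodule.eq_starProjection_of_mem_orthogonal
    (Submodule.mem_map_of_mem (hinv n v hv)) ?_).symm
  rw [Submodule.mem_orthogonal']
  rintro _ ⟨g, hg, rfl⟩
  have h0 : ⟪x - ι v, ι (T g)⟫_ℝ = 0 := by
    rw [hvx]
    exact Submodule.starProjection_inner_eq_zero x _ (Submodule.mem_map_of_mem (hinv n g hg))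
  rw [inner_sub_left, hxy, hsymm, ← inner_sub_left, h0]

variable (hmono : Monotone V)

include hmono hdense in
theorem tendsto_starProjection (x : H) :
    Filter.Tendsto (fun n => ((V n).map ι).starProjection x) Filter.atTop (𝓝 x) :=
  Submodule.starProjection_tendsto_self (fun n => (V n).map ι)
    (fun _ _ h => Submodule.map_mono (hmono h)) x hdense

include hsymm hinv hmono hdense in
/-- The weak and the strong extension of the operator agree: the projections of `x` and `y` to the
invariant subspaces form pairs in the graph of `T` that converge to `(x, y)`. -/
theorem mem_closedGraph_of_weak {x y : H} (hxy : ∀ g, ⟪y, ι g⟫_ℝ = ⟪x, ι (T g)⟫_ℝ) :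
    (x, y) ∈ closedGraph ι T := by
  choose v hv hvx using fun n => exists_lift_starProjection (ι := ι) (V := V) x n
  refine isClosed_closedGraph.mem_of_tendsto
    ((tendsto_starProjection hdense hmono x).prodMk_nhds (tendsto_starProjection hdense hmono y))
    (Filter.Eventually.of_forall fun n => ?_)
  rw [← starProjection_eq_of_weak hinv hxy hsymm (hv n) (hvx n), ← hvx n]
  exact mem_closedGraph _

include hsymm hinv hmono hdense in
/-- The closure of a symmetric operator with a dense increasing union of finite-dimensional
invariant subspaces is self-adjoint. -/
theorem isSelfAdjoint_closedGraph [CompleteSpace H] :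
    IsSelfAdjoint (closedGraph ι T).toLinearPMap := by
  have hg := graph_closedGraph (T := T) hsymm hdense
  have hd : Dense ((closedGraph ι T).toLinearPMap.domain : Set H) := by
    refine (dense_range_of_dense hdense).mono ?_
    rintro _ ⟨f, rfl⟩
    refine LinearPMap.mem_domain_of_mem_graph (y := ι (T f)) ?_
    rw [hg]
    exact mem_closedGraph f
  rw [LinearPMap.isSelfAdjoint_def]
  refine LinearPMap.eq_of_eq_graph ?_
  rw [LinearPMap.adjoint_graph_eq_graph_adjoint hd, hg]
  ext ⟨x, y⟩
  rw [Submodule.mem_adjoint_iff]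
  constructor
  · intro h
    refine mem_closedGraph_of_weak hsymm hdense hinv hmono fun g => ?_
    have := h _ _ (mem_closedGraph g)
    rw [real_inner_comm, ← sub_eq_zero.mp this, real_inner_comm]
  · intro h a b hab
    rw [sub_eq_zero]
    exact inner_eq_of_mem_closedGraph hsymm hab h

include hsymm hdense hinv in
/-- The orthogonal projections to the invariant subspaces commute with powers of the closure. -/
theorem starProjection_opPow {p : ℕ} {x y : H}
    (h : (x, y) ∈ (opPow (closedGraph ι T).toLinearPMap p).graph) {n : ℕ} {v : D} (hv : v ∈ V n)
    (hvx : ι v = ((V n).map ι).starProjection x) :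
    ι ((T ^ p) v) = ((V n).map ι).starProjection y ∧ (T ^ p) v ∈ V n := by
  induction p generalizing y with
  | zero =>
    obtain rfl := (mem_graph_opPow_zero _).mp h
    exact ⟨hvx, hv⟩
  | succ p ih =>
    obtain ⟨z, hz, hzy⟩ := (mem_graph_opPow_succ _ p).mp h
    obtain ⟨h1, h2⟩ := ih hz
    rw [graph_closedGraph hsymm hdense] at hzy
    rw [pow_succ', Module.End.mul_apply]
    exact ⟨starProjection_eq_of_weak hinv
      (fun g => inner_eq_of_mem_closedGraph hsymm hzy (mem_closedGraph g)) hsymm h2 h1,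
      hinv n _ h2⟩

include hsymm hinv hmono hdense in
/-- A vector in the domain of all powers of the closure is approximated by one sequence in `D`,
simultaneously for all powers. -/
theorem exists_seq_tendsto_opPow {x : H} {y : ℕ → H}
    (h : ∀ p, (x, y p) ∈ (opPow (closedGraph ι T).toLinearPMap p).graph) :
    ∃ v : ℕ → D, ∀ p, Filter.Tendsto (fun n => ι ((T ^ p) (v n))) Filter.atTop (𝓝 (y p)) := by
  choose v hv hvx using fun n => exists_lift_starProjection (ι := ι) (V := V) x n
  refine ⟨v, fun p => (tendsto_starProjection hdense hmono (y p)).congr fun n => ?_⟩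
  exact (starProjection_opPow hsymm hdense hinv (h p) (hv n) (hvx n)).1.symm

end Symmetric

/-! ### The domain of all powers of the shifted Laplacian -/

section Regularity

open Filter

theorem toL2_injective : Function.Injective toL2 := by
  intro f g h
  have h1 := ContinuousMap.toLp_injective (p := 2) (𝕜 := ℝ) surfaceMeasure
    (a₁ := toContinuous f) (a₂ := toContinuous g) h
  ext x
  exact congrArg (fun F : C(S2, ℝ) => F x) h1

theorem shiftedLaplacian_eq (k : ℝ) :
    shiftedLaplacian k = (closedGraph toL2 (smoothOp k)).toLinearPMap := rfl

theorem isSelfAdjoint_shiftedLaplacian (k : ℝ) : IsSelfAdjoint (shiftedLaplacian k) :=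
  isSelfAdjoint_closedGraph (inner_smoothOp k) dense_polySpace (fun _ _ h => smoothOp_mem k h)
    polySpace_mono

theorem mem_graph_opPow_toL2 (k : ℝ) (p : ℕ) (f : SmoothS2) :
    (toL2 f, toL2 ((smoothOp k ^ p) f)) ∈ (opPow (shiftedLaplacian k) p).graph :=
  mem_graph_opPow_smooth (inner_smoothOp k) dense_polySpace p f

theorem cutFun_sub (χ : ℝ → ℝ) (f g : SmoothS2) :
    cutFun χ (f - g : SmoothS2) = cutFun χ f - cutFun χ g := by
  funext y
  by_cases hy : y ≠ 0 <;> simp [cutFun, radialExt, hy, mul_sub]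

/-- A sequence of smooth functions to which all powers of `-Δ + k` can be applied with a convergent
result in `L²` has a smooth limit. -/
theorem exists_tendsto_toL2 {k : ℝ} (hk : 1 < k) {v : ℕ → SmoothS2}
    (hv : ∀ p, CauchySeq fun n => toL2 ((smoothOp k ^ p) (v n))) :
    ∃ f : SmoothS2, Tendsto (fun n => toL2 (v n)) atTop (𝓝 (toL2 f)) := by
  obtain ⟨χ, hχ, -, h1⟩ := exists_isRadialCutoff
  have hC : ∀ n : ℕ, UniformCauchySeqOn (fun N => iteratedFDeriv ℝ n (cutFun χ (v N))) atTop
      Set.univ := by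
    intro n
    obtain ⟨C, hC, hb⟩ := exists_norm_iteratedFDeriv_cutFun_le hk hχ n
    rw [Metric.uniformCauchySeqOn_iff]
    intro ε hε
    obtain ⟨N, hN⟩ := Metric.cauchySeq_iff.mp (hv (n + 1)) (ε / (C + 1)) (by positivity)
    refine ⟨N, fun a ha b hb' y _ => ?_⟩
    have h2 := hb (v a - v b) y
    have hca : ContDiff ℝ n (cutFun χ (v a)) :=
      (hχ.contDiff_cutFun (v a)).of_le (by exact_mod_cast le_top)
    have hcb : ContDiff ℝ n (cutFun χ (v b)) :=
      (hχ.contDiff_cutFun (v b)).of_le (by exact_mod_cast le_top)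
    rw [cutFun_sub, iteratedFDeriv_sub hca hcb, Pi.sub_apply, map_sub, map_sub,
      ← dist_eq_norm, ← dist_eq_norm] at h2
    have h3 := hN a ha b hb'
    calc _ ≤ C * dist (toL2 ((smoothOp k ^ (n + 1)) (v a))) (toL2 ((smoothOp k ^ (n + 1)) (v b))) :=
          h2
      _ ≤ C * (ε / (C + 1)) := by gcongr
      _ < ε := by
        rw [mul_div_assoc', div_lt_iff₀ (by positivity)]
        nlinarith
  obtain ⟨G, hG, hlim⟩ := exists_contDiff_tendsto (fun N => hχ.contDiff_cutFun (v N)) hC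
  have : Fact (Module.finrank ℝ E3 = 2 + 1) := ⟨by simp⟩
  let f : SmoothS2 := ⟨fun x : S2 => G x, hG.contMDiff.comp (contMDiff_coe_sphere (n := 2))⟩
  refine ⟨f, ?_⟩
  have hu : Tendsto (fun n => toContinuous (v n)) atTop (𝓝 (toContinuous f)) := by
    rw [ContinuousMap.tendsto_iff_tendstoUniformly]
    have hcut : ∀ n, cutFun χ (v n) ∘ (Subtype.val : S2 → E3) = v n := fun n => by
      funext x
      change cutFun χ (v n) x = v n x
      rw [cutFun, norm_sq_sphere, h1.self_of_nhds, one_mul, radialExt_apply_sphere]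
    have h2 := hlim.comp (Subtype.val : S2 → E3)
    simp only [hcut] at h2
    exact h2
  exact ((ContinuousMap.toLp 2 surfaceMeasure ℝ).continuous.tendsto _).comp hu

/-- A vector to which all powers of the shifted Laplacian can be applied is smooth. -/
theorem exists_toL2_eq {k : ℝ} (hk : 1 < k) {x : L2S2} {y : ℕ → L2S2}
    (h : ∀ p, (x, y p) ∈ (opPow (shiftedLaplacian k) p).graph) : ∃ f, toL2 f = x := by
  obtain ⟨v, hv⟩ := exists_seq_tendsto_opPow (inner_smoothOp k) dense_polySpace
    (fun _ _ h => smoothOp_mem k h) polySpace_mono h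
  obtain ⟨f, hf⟩ := exists_tendsto_toL2 hk fun p => (hv p).cauchySeq
  have hx : x = y 0 := (mem_graph_opPow_zero _).mp (h 0)
  exact ⟨f, (tendsto_nhds_unique hf (hv 0)).trans hx.symm⟩

theorem iInf_domain_opPow {k : ℝ} (hk : 1 < k) :
    (⨅ p : ℕ, (opPow (shiftedLaplacian k) p).domain) = smoothClasses := by
  refine le_antisymm (fun x hx => ?_) ?_
  · rw [Submodule.mem_iInf] at hx
    choose y hy using fun p => LinearPMap.mem_domain_iff.mp (hx p)
    exact exists_toL2_eq hk hy
  · rintro _ ⟨f, rfl⟩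
    rw [Submodule.mem_iInf]
    exact fun p => LinearPMap.mem_domain_of_mem_graph (mem_graph_opPow_toL2 k p f)

end Regularity

/-! ### The smooth topology -/

section SmoothTopology

open Filter

/-- The derivative of order `n` of the radially constant extension, on the sphere, with values in
the space of functions on the sphere with uniform convergence. -/
def sphereDeriv (n : ℕ) :
    SmoothS2 →+ UniformFun S2 (ContinuousMultilinearMap ℝ (fun _ : Fin n => E3) ℝ) where
  toFun f := UniformFun.ofFun fun x : S2 => iteratedFDeriv ℝ n (radialExt f) (x : E3)
  map_zero' := by
    have h : radialExt (0 : SmoothS2) = 0 := by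
      funext y
      by_cases hy : y ≠ 0 <;> simp [radialExt, hy]
    have h0 : iteratedFDeriv ℝ n (0 : E3 → ℝ) = 0 := iteratedFDeriv_fun_zero
    simp only [h, h0]
    rfl
  map_add' f g := by
    rw [← UniformFun.ofFun_add]
    congr 1
    funext x
    have hf : ContDiffAt ℝ n (radialExt f) (x : E3) :=
      (contDiffAt_radialExt f (sphere_ne_zero x)).of_le (by exact_mod_cast le_top)
    have hg : ContDiffAt ℝ n (radialExt g) (x : E3) :=
      (contDiffAt_radialExt g (sphere_ne_zero x)).of_le (by exact_mod_cast le_top)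
    rw [Pi.add_apply, ← iteratedFDeriv_add_apply hf hg]
    congr 1
    exact radialExt_add f g

theorem smoothTopology_eq : smoothTopology =
    ⨅ n : ℕ, TopologicalSpace.induced (sphereDeriv n) inferInstance := rfl

theorem isTopologicalAddGroup_smoothTopology :
    @IsTopologicalAddGroup SmoothS2 smoothTopology _ := by
  rw [smoothTopology_eq]
  exact topologicalAddGroup_iInf fun n => topologicalAddGroup_induced (sphereDeriv n)

/-- Convergence to zero along a filter, uniformly with all derivatives. -/
def SmallDerivs (l : Filter SmoothS2) : Prop :=
  ∀ (n : ℕ) (ε : ℝ), 0 < ε → ∀ᶠ f : SmoothS2 in l, ∀ x : S2,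
    ‖iteratedFDeriv ℝ n (radialExt f) (x : E3)‖ < ε

theorem le_nhds_zero_iff (l : Filter SmoothS2) :
    l ≤ @nhds SmoothS2 smoothTopology 0 ↔ SmallDerivs l := by
  rw [smoothTopology_eq, nhds_iInf, le_iInf_iff]
  refine forall_congr' fun n => ?_
  rw [nhds_induced, map_zero, ← tendsto_iff_comap, UniformFun.tendsto_iff_tendstoUniformly,
    Metric.tendstoUniformly_iff]
  refine forall_congr' fun ε => imp_congr Iff.rfl (eventually_congr (Eventually.of_forall
    fun f => forall_congr' fun x => ?_))
  rw [dist_comm, dist_eq_norm]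
  have : UniformFun.toFun (0 : UniformFun S2 (ContinuousMultilinearMap ℝ (fun _ : Fin n => E3) ℝ)) x
    = 0 := rfl
  rw [this, sub_zero]
  rfl

theorem contDiff_fderiv_fderiv_apply {F : E3 → ℝ} (hF : ContDiff ℝ ∞ F) (v w : E3) :
    ContDiff ℝ ∞ fun y => fderiv ℝ (fderiv ℝ F) y v w :=
  (((hF.fderiv_right (m := ∞) (by simp)).fderiv_right (m := ∞) (by simp)).clm_apply
    contDiff_const).clm_apply contDiff_const

theorem contDiff_laplacian {F : E3 → ℝ} (hF : ContDiff ℝ ∞ F) :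
    ContDiff ℝ ∞ (Laplacian.laplacian F) := by
  rw [funext (laplacian_eq_sum_fderiv F)]
  exact ContDiff.sum fun i _ => contDiff_fderiv_fderiv_apply hF _ _

theorem norm_iteratedFDeriv_fderiv_fderiv_apply_le {F : E3 → ℝ} (hF : ContDiff ℝ ∞ F) (n : ℕ)
    (x v : E3) (hv : ‖v‖ = 1) :
    ‖iteratedFDeriv ℝ n (fun y => fderiv ℝ (fderiv ℝ F) y v v) x‖ ≤
      ‖iteratedFDeriv ℝ (n + 2) F x‖ := by
  have h1 : ContDiff ℝ ∞ (fderiv ℝ (fderiv ℝ F)) :=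
    (hF.fderiv_right (m := ∞) (by simp)).fderiv_right (m := ∞) (by simp)
  have hn : (n : WithTop ℕ∞) ≤ ∞ := by exact_mod_cast le_top
  refine (norm_iteratedFDeriv_clm_apply_const (h1.clm_apply contDiff_const).contDiffAt hn).trans ?_
  rw [hv, one_mul]
  refine (norm_iteratedFDeriv_clm_apply_const h1.contDiffAt hn).trans ?_
  rw [hv, one_mul, norm_iteratedFDeriv_fderiv, norm_iteratedFDeriv_fderiv]

theorem norm_iteratedFDeriv_laplacian_le {F : E3 → ℝ} (hF : ContDiff ℝ ∞ F) (n : ℕ) (x : E3) :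
    ‖iteratedFDeriv ℝ n (Laplacian.laplacian F) x‖ ≤ 3 * ‖iteratedFDeriv ℝ (n + 2) F x‖ := by
  have hn : (n : WithTop ℕ∞) ≤ ∞ := by exact_mod_cast le_top
  rw [funext (laplacian_eq_sum_fderiv F), iteratedFDeriv_fun_sum_apply fun i _ =>
    ((contDiff_fderiv_fderiv_apply hF _ _).of_le hn).contDiffAt]
  refine (norm_sum_le _ _).trans ((Finset.sum_le_sum fun i _ =>
    norm_iteratedFDeriv_fderiv_fderiv_apply_le hF n x _ (by simp)).trans ?_)
  simp

/-- The Laplace–Beltrami operator is continuous for the smooth topology. The radially constant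
extension of `Δf` is `‖y‖²` times the Euclidean Laplacian of that of `f`; the cut-off serves to
apply global bounds for derivatives of a product. -/
theorem exists_norm_iteratedFDeriv_sphereLaplacian_le (n : ℕ) :
    ∃ C : ℝ, 0 ≤ C ∧ ∀ (f : SmoothS2) (M : ℝ) (x : S2),
      (∀ j ≤ n + 2, ‖iteratedFDeriv ℝ j (radialExt f) (x : E3)‖ ≤ M) →
        ‖iteratedFDeriv ℝ n (radialExt (sphereLaplacian f)) (x : E3)‖ ≤ C * M := by
  obtain ⟨χ, hχ, -, h1⟩ := exists_isRadialCutoff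
  have hN : ∀ i, ∃ B, 0 ≤ B ∧ ∀ x : S2,
      ‖iteratedFDeriv ℝ i (fun y : E3 => ‖y‖ ^ 2) (x : E3)‖ ≤ B := by
    intro i
    have hc : Continuous fun x : S2 => iteratedFDeriv ℝ i (fun y : E3 => ‖y‖ ^ 2) (x : E3) :=
      (ContDiff.continuous_iteratedFDeriv (n := ∞) (by exact_mod_cast le_top)
        (contDiff_norm_sq ℝ)).comp continuous_subtype_val
    obtain ⟨B, hB⟩ := isCompact_univ.exists_bound_of_continuousOn hc.continuousOn
    exact ⟨max B 0, le_max_right _ _, fun x => (hB x (Set.mem_univ x)).trans (le_max_left _ _)⟩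
  choose B hB0 hB using hN
  refine ⟨∑ i ∈ Finset.range (n + 1), (n.choose i : ℝ) * B i * 3,
    Finset.sum_nonneg fun i _ =>
      mul_nonneg (mul_nonneg (Nat.cast_nonneg _) (hB0 i)) zero_le_three, fun f M x hM => ?_⟩
  have hF := hχ.contDiff_cutFun f
  have hc : Tendsto (fun z : E3 => ‖z‖ ^ 2) (𝓝 (x : E3)) (𝓝 1) := by
    have : ContinuousAt (fun z : E3 => ‖z‖ ^ 2) (x : E3) := (continuous_norm.pow 2).continuousAt
    simpa [ContinuousAt, norm_sq_sphere x] using this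
  have h3 : cutFun χ f =ᶠ[𝓝 (x : E3)] radialExt f := by
    filter_upwards [hc.eventually h1] with y hy
    simp [cutFun, hy]
  have h4 : radialExt (sphereLaplacian f) =ᶠ[𝓝 (x : E3)]
      fun y => ‖y‖ ^ 2 * Laplacian.laplacian (cutFun χ f) y := by
    filter_upwards [InnerProductSpace.laplacian_congr_nhds h3,
      isOpen_compl_singleton.mem_nhds (sphere_ne_zero x)] with y hy hy0
    have hy0' : y ≠ 0 := hy0
    rw [hy, laplacian_radialExt f hy0']
    have : ‖y‖ ≠ 0 := norm_ne_zero_iff.mpr hy0'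
    field_simp
  rw [(h4.iteratedFDeriv ℝ n).eq_of_nhds]
  refine (norm_iteratedFDeriv_mul_le (N := ∞) (contDiff_norm_sq ℝ) (contDiff_laplacian hF) _
    (by exact_mod_cast le_top)).trans ?_
  rw [Finset.sum_mul]
  refine Finset.sum_le_sum fun i hi => ?_
  have hi' : n - i + 2 ≤ n + 2 := by omega
  have h5 := norm_iteratedFDeriv_laplacian_le hF (n - i) x
  rw [(h3.iteratedFDeriv ℝ (n - i + 2)).eq_of_nhds] at h5
  calc _ ≤ (n.choose i : ℝ) * B i * (3 * M) := by
        gcongr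
        · exact mul_nonneg (Nat.cast_nonneg _) (hB0 i)
        · exact hB i x
        · exact h5.trans (mul_le_mul_of_nonneg_left (hM _ hi') zero_le_three)
    _ = _ := by ring

theorem exists_norm_iteratedFDeriv_smoothOp_le (k : ℝ) (n : ℕ) :
    ∃ C : ℝ, 0 ≤ C ∧ ∀ (f : SmoothS2) (M : ℝ) (x : S2),
      (∀ j ≤ n + 2, ‖iteratedFDeriv ℝ j (radialExt f) (x : E3)‖ ≤ M) →
        ‖iteratedFDeriv ℝ n (radialExt (smoothOp k f)) (x : E3)‖ ≤ C * M := by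
  obtain ⟨C, hC, hb⟩ := exists_norm_iteratedFDeriv_sphereLaplacian_le n
  refine ⟨|k| + C, by positivity, fun f M x hM => ?_⟩
  have hf : ∀ g : SmoothS2, ContDiffAt ℝ n (radialExt g) (x : E3) := fun g =>
    (contDiffAt_radialExt g (sphere_ne_zero x)).of_le (by exact_mod_cast le_top)
  have h1 : radialExt (smoothOp k f) = k • radialExt f - radialExt (sphereLaplacian f) := by
    funext y
    rw [radialExt_smoothOp, Pi.sub_apply, Pi.smul_apply, smul_eq_mul]
    ring
  have hk : ContDiffAt ℝ n (k • radialExt f) (x : E3) := (hf f).const_smul k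
  rw [h1, iteratedFDeriv_sub_apply hk (hf _),
    iteratedFDeriv_const_smul_apply (hf f), add_mul]
  refine (norm_sub_le _ _).trans (add_le_add ?_ (hb f M x hM))
  rw [norm_smul, Real.norm_eq_abs]
  exact mul_le_mul_of_nonneg_left (hM n (by omega)) (abs_nonneg k)

theorem SmallDerivs.smoothOp {l : Filter SmoothS2} (h : SmallDerivs l) (k : ℝ) :
    SmallDerivs (l.map (smoothOp k)) := by
  intro n ε hε
  obtain ⟨C, hC, hb⟩ := exists_norm_iteratedFDeriv_smoothOp_le k n
  rw [eventually_map]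
  have h1 : ∀ᶠ f : SmoothS2 in l, ∀ j ∈ Finset.range (n + 3), ∀ x : S2,
      ‖iteratedFDeriv ℝ j (radialExt f) (x : E3)‖ < ε / (C + 1) :=
    (Filter.eventually_all_finset _).mpr fun j _ => h j _ (by positivity)
  filter_upwards [h1] with f hf x
  refine (hb f (ε / (C + 1)) x fun j hj =>
    (hf j (Finset.mem_range.mpr (by omega)) x).le).trans_lt ?_
  rw [mul_div_assoc', div_lt_iff₀ (by positivity)]
  nlinarith

theorem SmallDerivs.smoothOp_pow {l : Filter SmoothS2} (h : SmallDerivs l) (k : ℝ) (p : ℕ) :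
    SmallDerivs (l.map (BMS.smoothOp k ^ p)) := by
  induction p with
  | zero => exact h
  | succ p ih => exact (pow_succ' (BMS.smoothOp k) p).symm ▸ ih.smoothOp k

theorem SmallDerivs.tendsto_norm_toL2 {l : Filter SmoothS2} (h : SmallDerivs l) :
    Tendsto (fun f => ‖toL2 f‖) l (𝓝 0) := by
  have h1 : Tendsto toContinuous l (𝓝 0) := by
    rw [ContinuousMap.tendsto_iff_tendstoUniformly, Metric.tendstoUniformly_iff]
    intro ε hε
    filter_upwards [h 0 ε hε] with f hf x
    have h2 := hf x
    rw [norm_iteratedFDeriv_zero, radialExt_apply_sphere] at h2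
    rw [dist_comm, dist_eq_norm]
    change ‖f x - 0‖ < ε
    rwa [sub_zero]
  have h2 := ((ContinuousMap.toLp 2 surfaceMeasure ℝ).continuous.tendsto 0).comp h1
  rw [map_zero] at h2
  exact tendsto_zero_iff_norm_tendsto_zero.mp h2

/-- The smooth topology is generated by the norms `‖(-Δ + k) ^ p f‖`: one direction is the
continuity of the operator, the other one the elliptic estimate. -/
theorem smallDerivs_iff {k : ℝ} (hk : 1 < k) (l : Filter SmoothS2) :
    SmallDerivs l ↔ ∀ p : ℕ, Tendsto (fun f => ‖toL2 ((smoothOp k ^ p) f)‖) l (𝓝 0) := by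
  refine ⟨fun h p => (h.smoothOp_pow k p).tendsto_norm_toL2.comp tendsto_map, fun h n ε hε => ?_⟩
  obtain ⟨C, hC, hb⟩ := exists_norm_iteratedFDeriv_radialExt_le hk n
  have hpos : 0 < ε / (C + 1) := by positivity
  filter_upwards [(h (n + 1)).eventually (gt_mem_nhds hpos)] with f hf x
  calc _ ≤ C * ‖toL2 ((smoothOp k ^ (n + 1)) f)‖ := hb f x
    _ ≤ C * (ε / (C + 1)) := by gcongr
    _ < ε := by
      rw [mul_div_assoc', div_lt_iff₀ (by positivity)]
      nlinarith

end SmoothTopology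

/-! ### The inner products on supertranslations -/

section Supertranslations

open Filter

/-- The smooth functions are identified with the supertranslations. -/
def smoothEquiv : SmoothS2 ≃ₗ[ℝ] Supertranslation :=
  LinearEquiv.ofInjective toL2 toL2_injective

theorem val_smoothEquiv (f : SmoothS2) : (smoothEquiv f).val = toL2 f := rfl

theorem topology_eq_induced :
    instTopologicalSpaceSupertranslation =
      TopologicalSpace.induced smoothEquiv.symm smoothTopology := by
  have h : (Supertranslation.mk : SmoothS2 → Supertranslation) = smoothEquiv.toEquiv := rfl
  rw [instTopologicalSpaceSupertranslation, h, ← Equiv.induced_symm]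
  rfl

instance isTopologicalAddGroup_supertranslation : IsTopologicalAddGroup Supertranslation := by
  rw [topology_eq_induced]
  let _ := smoothTopology
  have := isTopologicalAddGroup_smoothTopology
  exact topologicalAddGroup_induced smoothEquiv.symm

theorem le_nhds_zero_supertranslation_iff (l : Filter Supertranslation) :
    l ≤ 𝓝 0 ↔ SmallDerivs (l.map smoothEquiv.symm) := by
  let _ := smoothTopology
  rw [topology_eq_induced, nhds_induced, map_zero, ← le_nhds_zero_iff, map_le_iff_le_comap]

/-- The inner product `⟨A ^ p f, A ^ p g⟩` on the supertranslations. -/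
@[reducible] def powCore {k : ℝ} (hk : 1 < k) (p : ℕ) :
    InnerProductSpace.Core ℝ Supertranslation where
  inner f g := ⟪toL2 ((smoothOp k ^ p) (smoothEquiv.symm f)),
    toL2 ((smoothOp k ^ p) (smoothEquiv.symm g))⟫_ℝ
  conj_inner_symm f g := by
    rw [conj_trivial]
    exact real_inner_comm _ _
  re_inner_nonneg f := by
    rw [RCLike.re_to_real]
    exact real_inner_self_nonneg
  add_left f g h := by simp only [map_add, inner_add_left]
  smul_left f g r := by simp only [map_smul, real_inner_smul_left]; rfl
  definite f hf := by
    have h0 : toL2 ((smoothOp k ^ p) (smoothEquiv.symm f)) = 0 := inner_self_eq_zero.mp hf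
    have h1 := norm_toL2_le_pow hk (smoothEquiv.symm f) (Nat.zero_le p)
    rw [h0, norm_zero, pow_zero, Module.End.one_apply] at h1
    have h2 : toL2 (smoothEquiv.symm f) = toL2 0 := by
      rw [map_zero]
      exact norm_le_zero_iff.mp h1
    exact (LinearEquiv.map_eq_zero_iff _).mp (toL2_injective h2)

theorem powCore_inner {k : ℝ} (hk : 1 < k) (p : ℕ) (f g : Supertranslation) :
    (powCore hk p).inner f g = ⟪toL2 ((smoothOp k ^ p) (smoothEquiv.symm f)),
      toL2 ((smoothOp k ^ p) (smoothEquiv.symm g))⟫_ℝ := rfl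

theorem innerNorm_powCore {k : ℝ} (hk : 1 < k) (p : ℕ) (f : Supertranslation) :
    innerNorm (powCore hk p) f = ‖toL2 ((smoothOp k ^ p) (smoothEquiv.symm f))‖ := by
  change Real.sqrt ⟪toL2 ((smoothOp k ^ p) (smoothEquiv.symm f)),
    toL2 ((smoothOp k ^ p) (smoothEquiv.symm f))⟫_ℝ = _
  rw [real_inner_self_eq_norm_sq, Real.sqrt_sq (norm_nonneg _)]

/-- The powers of the closed operator act on smooth classes as the differential operator. -/
theorem opPow_val (k : ℝ) (p : ℕ) (f : Supertranslation)
    (hf : f.val ∈ (opPow (shiftedLaplacian k) p).domain) :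
    opPow (shiftedLaplacian k) p ⟨f.val, hf⟩ = toL2 ((smoothOp k ^ p) (smoothEquiv.symm f)) := by
  have h1 := mem_graph_opPow_toL2 k p (smoothEquiv.symm f)
  rw [← val_smoothEquiv, LinearEquiv.apply_symm_apply] at h1
  exact LinearPMap.mem_graph_snd_inj _ (LinearPMap.mem_graph _ ⟨f.val, hf⟩) h1 rfl

theorem withSeminorms_powCore {k : ℝ} (hk : 1 < k) :
    WithSeminorms (fun p : ℕ => innerNorm (powCore hk p)) := by
  rw [SeminormFamily.withSeminorms_iff_nhds_eq_iInf]
  refine eq_of_forall_le_iff fun l => ?_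
  rw [le_nhds_zero_supertranslation_iff, smallDerivs_iff hk, le_iInf_iff]
  refine forall_congr' fun p => ?_
  rw [tendsto_map'_iff, ← tendsto_iff_comap]
  refine Eq.to_iff (congrArg (fun F => Tendsto F l (𝓝 0)) (funext fun f => ?_))
  exact (innerNorm_powCore hk p f).symm

theorem isCountablyHilbert_powCore {k : ℝ} (hk : 1 < k) :
    IsCountablyHilbert (powCore hk) where
  withSeminorms := withSeminorms_powCore hk
  complete u hu := by
    have hc : ∀ p, CauchySeq fun n => toL2 ((smoothOp k ^ p) (smoothEquiv.symm (u n))) := by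
      intro p
      rw [Metric.cauchySeq_iff]
      intro ε hε
      obtain ⟨N, hN⟩ := hu p ε hε
      refine ⟨N, fun m hm n hn => ?_⟩
      have h := hN m n hm hn
      rwa [innerNorm_powCore, map_sub, map_sub, map_sub, ← dist_eq_norm] at h
    obtain ⟨f, hf⟩ := exists_tendsto_toL2 hk hc
    choose y hy using fun p => cauchySeq_tendsto_of_complete (hc p)
    -- As the operator is closed, the limits `y p` are its powers applied to the smooth limit `f`.
    have hy0 : y 0 = toL2 f := tendsto_nhds_unique (hy 0) hf
    have hg : ∀ p, (toL2 f, y p) ∈ (opPow (shiftedLaplacian k) p).graph := by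
      intro p
      induction p with
      | zero => exact (mem_graph_opPow_zero _).mpr hy0.symm
      | succ p ih =>
        refine (mem_graph_opPow_succ _ p).mpr ⟨y p, ih, ?_⟩
        rw [shiftedLaplacian_eq, graph_closedGraph (inner_smoothOp k) dense_polySpace]
        refine isClosed_closedGraph.mem_of_tendsto ((hy p).prodMk_nhds (hy (p + 1)))
          (Eventually.of_forall fun n => ?_)
        rw [pow_succ', Module.End.mul_apply]
        exact mem_closedGraph _
    refine ⟨smoothEquiv f, fun p => ?_⟩
    have h1 : y p = toL2 ((smoothOp k ^ p) f) :=
      LinearPMap.mem_graph_snd_inj _ (hg p) (mem_graph_opPow_toL2 k p f) rfl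
    have h2 := tendsto_iff_norm_sub_tendsto_zero.mp (hy p)
    rw [h1] at h2
    refine h2.congr fun n => ?_
    rw [innerNorm_powCore, map_sub, map_sub, map_sub, LinearEquiv.symm_apply_apply]

/-- Finitely many smooth functions that the operator `-Δ + k` maps to an orthonormal family have a
pointwise bounded sum of squares. -/
theorem exists_sum_sq_le {k : ℝ} (hk : 1 < k) : ∃ C : ℝ, ∀ (n : ℕ) (g : Fin n → SmoothS2),
    (Orthonormal ℝ fun i => toL2 (smoothOp k (g i))) → ∀ x : S2, ∑ i, g i x * g i x ≤ C := by
  obtain ⟨C, hC, hb⟩ := exists_norm_iteratedFDeriv_radialExt_le hk 0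
  refine ⟨C ^ 2, fun n g hg x => ?_⟩
  set s := ∑ i, g i x * g i x with hs
  have hs0 : 0 ≤ s := Finset.sum_nonneg fun i _ => mul_self_nonneg _
  -- The sup bound is applied to the combination of the family that is extremal at `x`.
  have h1 := hb (∑ i, g i x • g i) x
  rw [norm_iteratedFDeriv_zero, radialExt_apply_sphere] at h1
  have h2 : (∑ i, g i x • g i : SmoothS2) x = s := by
    have : (∑ i, g i x • g i : SmoothS2) x = ∑ i, (g i x • g i : SmoothS2) x :=
      map_sum (ContMDiffMap.evalRingHom x : SmoothS2 →+* ℝ) _ _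
    rw [this]
    rfl
  have h3 : ‖toL2 ((smoothOp k ^ (0 + 1)) (∑ i, g i x • g i))‖ = Real.sqrt s := by
    have h4 : ‖toL2 ((smoothOp k ^ (0 + 1)) (∑ i, g i x • g i))‖ ^ 2 = s := by
      rw [zero_add, pow_one, ← real_inner_self_eq_norm_sq]
      simp only [map_sum, map_smul]
      rw [hg.inner_sum]
      rfl
    rw [← h4, Real.sqrt_sq (norm_nonneg _)]
  rw [h2, h3, Real.norm_of_nonneg hs0] at h1
  have h5 : Real.sqrt s ≤ C := by
    rcases (Real.sqrt_nonneg s).eq_or_lt with h | h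
    · rw [← h]
      exact hC
    · refine le_of_mul_le_mul_right ?_ h
      rwa [Real.mul_self_sqrt hs0]
  rw [← Real.sq_sqrt hs0]
  exact pow_le_pow_left₀ (Real.sqrt_nonneg s) h5 2

/-- The pointwise bound for the sum of squares is integrated over the sphere. -/
theorem isHilbertSchmidtInclusion_powCore {k : ℝ} (hk : 1 < k) (p : ℕ) :
    IsHilbertSchmidtInclusion (powCore hk (p + 1)) (powCore hk p) := by
  obtain ⟨C, hC⟩ := exists_sum_sq_le hk
  refine ⟨∫ _ : S2, C ∂surfaceMeasure, fun n e he => ?_⟩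
  set g : Fin n → SmoothS2 := fun i => (smoothOp k ^ p) (smoothEquiv.symm (e i)) with hg
  have horth : Orthonormal ℝ fun i => toL2 (smoothOp k (g i)) := by
    rw [orthonormal_iff_ite]
    intro i j
    have h := he i j
    rw [powCore_inner, pow_succ', Module.End.mul_apply, Module.End.mul_apply] at h
    exact h
  have h1 : ∑ i, innerNorm (powCore hk p) (e i) ^ 2 =
      ∫ x, ∑ i, g i x * g i x ∂surfaceMeasure := by
    rw [MeasureTheory.integral_finsetSum (f := fun i x => g i x * g i x) _
      fun i _ => integrable_sphere (g i * g i)]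
    refine Finset.sum_congr rfl fun i _ => ?_
    rw [innerNorm_powCore, norm_sq_toL2]
  rw [h1]
  exact MeasureTheory.integral_mono
    (MeasureTheory.integrable_finsetSum _ fun i _ => integrable_sphere (g i * g i))
    (MeasureTheory.integrable_const C) (hC n g horth)

/-- A point of the sphere with prescribed first coordinate. -/
theorem exists_coord_eq {t : ℝ} (ht : t ∈ Set.Icc (0 : ℝ) 1) : ∃ x : S2, coord 0 x = t := by
  refine ⟨⟨!₂[t, Real.sqrt (1 - t ^ 2), 0], ?_⟩, rfl⟩
  have h : 0 ≤ 1 - t ^ 2 := by nlinarith [ht.1, ht.2]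
  rw [mem_sphere_zero_iff_norm, EuclideanSpace.norm_eq]
  simp [Fin.sum_univ_three, Real.sq_sqrt h]

/-- In a finite-dimensional algebra a coordinate would be a root of a nonzero polynomial, which
would vanish at all its values. -/
theorem not_finiteDimensional_smoothS2 : ¬ FiniteDimensional ℝ SmoothS2 := by
  intro h
  obtain ⟨q, hq, hq0⟩ := IsIntegral.of_finite ℝ (coord 0)
  refine hq.ne_zero (Polynomial.eq_zero_of_infinite_isRoot q
    ((Set.Icc_infinite (zero_lt_one' ℝ)).mono fun t ht => ?_))
  obtain ⟨x, rfl⟩ := exists_coord_eq ht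
  have h1 := congrArg (ContMDiffMap.evalRingHom x : SmoothS2 →+* ℝ) hq0
  rw [Polynomial.hom_eval₂, map_zero, Subsingleton.elim
    ((ContMDiffMap.evalRingHom x : SmoothS2 →+* ℝ).comp (algebraMap ℝ SmoothS2))
    (RingHom.id ℝ)] at h1
  exact h1

theorem isCountablyHilbertNuclear_supertranslation :
    IsCountablyHilbertNuclear ℝ Supertranslation :=
  ⟨powCore one_lt_two, isCountablyHilbert_powCore one_lt_two, fun p =>
    ⟨p + 1, Nat.le_succ p, isHilbertSchmidtInclusion_powCore one_lt_two p⟩⟩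

end Supertranslations
end BMS

theorem mainTheorem1 :
    BMS.IsNuclearLieGroup ℝ BMS.Supertranslation ∧
    ¬ FiniteDimensional ℝ BMS.Supertranslation ∧
    ∀ k : ℝ, 1 < k →
      IsSelfAdjoint (BMS.shiftedLaplacian k) ∧
      (⨅ p : ℕ, (BMS.opPow (BMS.shiftedLaplacian k) p).domain) = BMS.smoothClasses ∧
      ∃ c : ℕ → InnerProductSpace.Core ℝ BMS.Supertranslation,
        (∀ (p : ℕ) (f g : BMS.Supertranslation)
          (hf : f.val ∈ (BMS.opPow (BMS.shiftedLaplacian k) p).domain)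
          (hg : g.val ∈ (BMS.opPow (BMS.shiftedLaplacian k) p).domain),
          (c p).inner f g =
            ⟪BMS.opPow (BMS.shiftedLaplacian k) p ⟨f.val, hf⟩,
              BMS.opPow (BMS.shiftedLaplacian k) p ⟨g.val, hg⟩⟫_ℝ) ∧
        BMS.IsCountablyHilbert c ∧
        ∀ p : ℕ, BMS.IsHilbertSchmidtInclusion (c (p + 1)) (c p) := by
  refine ⟨⟨inferInstance, BMS.Supertranslation, inferInstance, inferInstance, inferInstance,
      BMS.isCountablyHilbertNuclear_supertranslation, Set.univ, Filter.univ_mem, Set.univ,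
      Filter.univ_mem, Homeomorph.refl _, fun g hg => hg⟩, fun h => ?_, fun k hk => ?_⟩
  · exact BMS.not_finiteDimensional_smoothS2 (BMS.smoothEquiv.symm.finiteDimensional)
  · refine ⟨BMS.isSelfAdjoint_shiftedLaplacian k, BMS.iInf_domain_opPow hk, BMS.powCore hk,
      fun p f g hf hg => ?_, BMS.isCountablyHilbert_powCore hk,
      BMS.isHilbertSchmidtInclusion_powCore hk⟩
    rw [BMS.opPow_val, BMS.opPow_val, BMS.powCore_inner]
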